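/- Let $N\ge 1$ be an integer and let $a>-1$ be real with $a\neq-\tfrac12$. Let $\rho$ be the eigenvalue density of the symmetric Jacobi ensemble with $\beta=2$ on $(-1,1)$, normalised to total mass $N$, that is, $$\rho(x)=\frac{N}{\mathcal N}\,(1-x^2)^a\int_{(-1,1)^{N-1}}\prod_{l=2}^N(1-x_l^2)^a|x-x_l|^2\prod_{2\le j<l\le N}|x_l-x_j|^2\,dx_2\cdots dx_N,\qquad -1<x<1,$$ where $\mathcal N=\int_{(-1,1)^N}\prod_{l=1}^N(1-x_l^2)^a\prod_{1\le j<l\le N}|x_l-x_j|^2\,dx_1\cdots dx_N$. For complex $k$ with $\operatorname{Re}k>-\tfrac12$ put $$m_{2k}=\int_{-1}^1|x|^{2k}\rho(x)\,dx,\qquad \mu_k=m_{2k+2}-m_{2k},\qquad \tilde\mu_k=\frac{\Gamma(k+N+a+\frac32)}{\Gamma(k+\frac12)}\,\mu_k .$$ Write $(z)_n=z(z+1)\cdots(z+n-1)$, and let $$S_n(x;a_1,b_1,c_1,d_1)=i^n\frac{(a_1+c_1)_n(a_1+d_1)_n}{n!}\;{}_3F_2\!\left({-n,\;n+a_1+b_1+c_1+d_1-1,\;a_1+ix\atop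 a_1+c_1,\;a_1+d_1};1\right),\qquad s_n(x;a_1,b_1)=S_n(x;a_1,b_1,\overline{a_1},\overline{b_1})$$ be the continuous Hahn polynomials. Then for every complex $k$ with $\operatorname{Re}k>-\tfrac12$ the integrals defining $m_{2k}$ and $m_{2k+2}$ converge absolutely, $$\tilde\mu_0=\frac{\Gamma(N+a+\frac32)}{\Gamma(\frac12)}\cdot\frac{2N(a+N)(2a+N)}{1-4(a+N)^2},$$ $$\tilde\mu_k=\frac{\tilde\mu_0\,i^{1-N}}{N\,(\frac32-(a+N))_{N-1}}\;s_{N-1}\!\left(i(k+1);1,\tfrac12-(a+N)\right),$$ and hence $$\mu_k=\frac{\tilde\mu_0\,i^{1-N}\,\Gamma(k+\frac12)}{N\,\Gamma(k+N+a+\frac32)\,(\frac32-(a+N))_{N-1}}\;s_{N-1}\!\left(i(k+1);1,\tfrac12-(a+N)\right).$$ -/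

import Mathlib

open scoped BigOperators

noncomputable section

/-- The Jacobi weight `(1 - x)^a (1 + x)^b` supported on `(-1, 1)`. -/
def jacobiWeight (a b x : ℝ) : ℝ :=
  Set.indicator (Set.Ioo (-1 : ℝ) 1) (fun t => (1 - t) ^ a * (1 + t) ^ b) x

/-- The unnormalised joint eigenvalue density
`∏_l w(x_l) ∏_{j < k} |x_k - x_j|^β` of the Jacobi `β`-ensemble with `n` eigenvalues. -/
def jacobiJoint (β a b : ℝ) (n : ℕ) (x : Fin n → ℝ) : ℝ :=
  (∏ l, jacobiWeight a b (x l)) * ∏ j, ∏ k ∈ Finset.Ioi j, |x k - x j| ^ β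

/-- The normalisation of the Jacobi `β`-ensemble with `N` eigenvalues. -/
def jacobiNorm (β a b : ℝ) (N : ℕ) : ℝ :=
  ∫ x : Fin N → ℝ, jacobiJoint β a b N x

/-- The eigenvalue density `ρ_{(1)}` of the Jacobi `β`-ensemble with `N ≥ 1` eigenvalues (with
total mass `N`): all variables but one are integrated out of the joint density. -/
def jacobiDensity (β a b : ℝ) (N : ℕ) (x : ℝ) : ℝ :=
  N * (jacobiWeight a b x / jacobiNorm β a b N) *
    ∫ y : Fin (N - 1) → ℝ, (∏ l, |x - y l| ^ β) * jacobiJoint β a b (N - 1) y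

/-- The absolute moment `m_{2k} = ∫_{-1}^1 |x|^{2k} ρ_{(1)}(x) dx` of the symmetric (`a = b`) Jacobi
ensemble, for complex `k`. -/
def jacobiMoment (β a : ℝ) (N : ℕ) (k : ℂ) : ℂ :=
  ∫ x in (-1 : ℝ)..1, ((|x| : ℝ) : ℂ) ^ (2 * k) * (jacobiDensity β a a N x : ℂ)

/-- The moment difference `μ_k = m_{2k+2} - m_{2k}`. -/
def jacobiMu (β a : ℝ) (N : ℕ) (k : ℂ) : ℂ :=
  jacobiMoment β a N (k + 1) - jacobiMoment β a N k

/-- The rescaled moment difference `μ̃_k`, defined through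
`μ_k = Γ(k + 1/2) / Γ(k + β(N-1)/2 + a + 5/2) * μ̃_k`. -/
def jacobiMuTilde (β a : ℝ) (N : ℕ) (k : ℂ) : ℂ :=
  Complex.Gamma (k + β * (N - 1) / 2 + a + 5 / 2) / Complex.Gamma (k + 1 / 2) * jacobiMu β a N k

/-- The closed form of the value at `k = 0` of the rescaled moment difference for `β = 2`. -/
def jacobiMuTildeZero (a : ℝ) (N : ℕ) : ℂ :=
  Complex.Gamma (N + a + 3 / 2) / Complex.Gamma (1 / 2) *
    (2 * N * (a + N) * (2 * a + N) / (1 - 4 * (a + N) ^ 2))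

/-- The Pochhammer symbol `(z)_n = z (z + 1) ⋯ (z + n - 1)`. -/
def poch (z : ℂ) (n : ℕ) : ℂ := (ascPochhammer ℂ n).eval z

/-- The hypergeometric series `₃F₂(a₁, a₂, a₃; b₁, b₂; z)`. -/
def hypergeometric32 (a₁ a₂ a₃ b₁ b₂ z : ℂ) : ℂ :=
  ∑' j : ℕ, poch a₁ j * poch a₂ j * poch a₃ j / (poch b₁ j * poch b₂ j) * (z ^ j / (j.factorial : ℂ))

/-- The continuous Hahn polynomial `S_n(x; a, b, c, d)`. -/
def continuousHahn (n : ℕ) (x a b c d : ℂ) : ℂ :=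
  Complex.I ^ n * (poch (a + c) n * poch (a + d) n / (n.factorial : ℂ)) *
    hypergeometric32 (-(n : ℂ)) (n + a + b + c + d - 1) (a + Complex.I * x) (a + c) (a + d) 1

/-- The specialised polynomial `s_n(x; a, b) = S_n(x; a, b, ā, b̄)`. -/
def continuousHahnConj (n : ℕ) (x a b : ℂ) : ℂ :=
  continuousHahn n x a b (starRingEnd ℂ a) (starRingEnd ℂ b)

end

/-!
Write `N = n + 1` and `c = a + N`, let `p_j` be the monic orthogonal polynomials for the weight
`w = (1 - x²)^a` on `(-1, 1)`, and `h_j = ∫ p_j² w`. The proof shows that both sides are polynomials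
of degree at most `n` in `k` which satisfy the same difference equation.

* Expanding the squared Vandermonde determinant in the `p_j` gives `ρ = w ∑_{j < N} p_j² / h_j`
  (`jacobiDensity_two`), and the confluent Christoffel-Darboux formula
  (`IsPearson.christoffelDarboux`) turns the kernel into `W / h_n`, where
  `W = p_N' p_n - p_N p_n'` has degree `2 n`. Hence `μ_k` is `-1 / h_n` times the integral of
  `|x|^{2k} (1 - x²)^{a+1} W(x)` (`jacobiMu_two`).
* Integrating the monomials of `W` gives Beta functions, and the Gamma factors in the definition of
  the rescaled moment difference cancel all but Pochhammer products. The result is a polynomial in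
  `k` of degree at most `n`, valid on the whole half-plane `Re k > -1/2`
  (`exists_polynomial_abs_mellin`).
* At natural numbers `k` the integrals are values of a linear functional on polynomials which
  satisfies Pearson's equation. The raising and lowering relations make `p_N²`, `p_N p_n`, `p_n²` a
  closed first-order system, and eliminating two of the three moment sequences leaves a three-term
  recurrence for the moments of `(1 - x²) W` (`IsPearson.wronskianMoment_recurrence`).
* After rescaling, that recurrence is the difference equation of the continuous Hahn polynomials,
  which the terminating `₃F₂` satisfies because the difference operator is bidiagonal on the basis
  `(-k)_j` (`hahnPolynomial_operator`). The equation at `k = 0, …, n - 1` and the value at `k = 0`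
  determine a polynomial of degree at most `n` (`eq_hahnPolynomial_of_operator`).
* The value `μ_0` is `-2 c h_N / h_n`, and `h_N / h_n` is the recurrence coefficient
  `N (N + 2a) / ((2c + 1) (2c - 1))`.
-/

open MeasureTheory Polynomial

/-! ### Absolute moments of `(1 - x²)^b` -/

/-- The substitution `y = x²` reduces the Mellin transform of `(1 - x²)^b` to a Beta integral. -/
theorem mellin_beta_half {u : ℂ} (hu : 0 < u.re) {b : ℝ} (hb : -1 < b) :
    IntervalIntegrable (fun x : ℝ => (x : ℂ) ^ (2 * u - 1) * (((1 - x ^ 2) ^ b : ℝ) : ℂ))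
      volume 0 1 ∧
    ∫ x in (0 : ℝ)..1, (x : ℂ) ^ (2 * u - 1) * (((1 - x ^ 2) ^ b : ℝ) : ℂ) =
      Complex.betaIntegral u (b + 1) / 2 := by
  have hv : 0 < ((b : ℂ) + 1).re := by simp; linarith
  set g : ℝ → ℂ := (Set.Ioo (0 : ℝ) 1).indicator
    (fun x : ℝ => (x : ℂ) ^ (u - 1) * (1 - (x : ℂ)) ^ ((b : ℂ) + 1 - 1)) with hg
  set F : ℝ → ℂ := fun x : ℝ => (x : ℂ) ^ (2 * u - 1) * (((1 - x ^ 2) ^ b : ℝ) : ℂ) with hF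
  have hsub : ∀ x ∈ Set.Ioi (0 : ℝ), ((2 : ℝ) * x ^ ((2 : ℝ) - 1)) • g (x ^ (2 : ℝ)) =
      (Set.Ioo (0 : ℝ) 1).indicator (fun x => 2 * F x) x := by
    intro x hx
    have hx0 : (0 : ℝ) < x := hx
    have h1 : (2 : ℝ) - 1 = 1 := by norm_num
    rw [h1, Real.rpow_one, Real.rpow_two]
    by_cases hx1 : x < 1
    · have m1 : x ^ 2 ∈ Set.Ioo (0 : ℝ) 1 := ⟨by positivity, by nlinarith⟩
      have m2 : x ∈ Set.Ioo (0 : ℝ) 1 := ⟨hx0, hx1⟩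
      have hs : 0 ≤ 1 - x ^ 2 := by nlinarith
      rw [hg, Set.indicator_of_mem m1, Set.indicator_of_mem m2, hF]
      have e1 : ((x ^ 2 : ℝ) : ℂ) ^ (u - 1) * (x : ℂ) = (x : ℂ) ^ (2 * u - 1) := by
        have hxc : (x : ℂ) ≠ 0 := by exact_mod_cast hx0.ne'
        have : ((x ^ 2 : ℝ) : ℂ) = (x : ℂ) * (x : ℂ) := by push_cast; ring
        rw [this, Complex.mul_cpow_ofReal_nonneg hx0.le hx0.le]
        nth_rewrite 3 [← Complex.cpow_one (x : ℂ)]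
        rw [← Complex.cpow_add _ _ hxc, ← Complex.cpow_add _ _ hxc]
        ring_nf
      have e2 : (1 - ((x ^ 2 : ℝ) : ℂ)) ^ ((b : ℂ) + 1 - 1) = (((1 - x ^ 2) ^ b : ℝ) : ℂ) := by
        rw [Complex.ofReal_cpow hs]; push_cast; ring_nf
      beta_reduce
      rw [e2, ← e1, Complex.real_smul]
      push_cast; ring
    · have m1 : x ^ 2 ∉ Set.Ioo (0 : ℝ) 1 := fun h => by nlinarith [h.2]
      have m2 : x ∉ Set.Ioo (0 : ℝ) 1 := fun h => hx1 h.2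
      rw [hg, Set.indicator_of_notMem m1, Set.indicator_of_notMem m2, smul_zero]
  have hint : IntegrableOn g (Set.Ioi 0) := by
    have h := Complex.betaIntegral_convergent hu hv
    rw [intervalIntegrable_iff_integrableOn_Ioo_of_le zero_le_one] at h
    rw [hg]
    exact ((integrable_indicator_iff measurableSet_Ioo).2 h).integrableOn
  have hgi : ∫ y in Set.Ioi (0 : ℝ), g y = Complex.betaIntegral u (b + 1) := by
    rw [hg, setIntegral_indicator measurableSet_Ioo, Complex.betaIntegral,
      intervalIntegral.integral_of_le zero_le_one, integral_Ioc_eq_integral_Ioo,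
      Set.inter_eq_right.2 Set.Ioo_subset_Ioi_self]
  have hFi : IntegrableOn (fun x => 2 * F x) (Set.Ioo 0 1) := by
    have h := (integrableOn_Ioi_comp_rpow_iff g (two_ne_zero (α := ℝ))).2 hint
    rw [abs_of_pos (zero_lt_two (α := ℝ)), integrableOn_congr_fun hsub measurableSet_Ioi,
      IntegrableOn, integrable_indicator_iff measurableSet_Ioo, IntegrableOn,
      Measure.restrict_restrict measurableSet_Ioo,
      Set.inter_eq_left.2 Set.Ioo_subset_Ioi_self] at h
    exact h
  constructor
  · rw [intervalIntegrable_iff_integrableOn_Ioo_of_le zero_le_one]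
    exact (hFi.const_mul (1 / 2)).congr (Filter.Eventually.of_forall fun x => by
      simp)
  · have h := integral_comp_rpow_Ioi_of_pos (g := g) (zero_lt_two (α := ℝ))
    rw [setIntegral_congr_fun measurableSet_Ioi hsub, setIntegral_indicator measurableSet_Ioo,
      Set.inter_eq_right.2 Set.Ioo_subset_Ioi_self, integral_const_mul, hgi] at h
    rw [intervalIntegral.integral_of_le zero_le_one, integral_Ioc_eq_integral_Ioo, ← h]
    ring

theorem abs_mellin_monomial {k : ℂ} (hk : -1 / 2 < k.re) {b : ℝ} (hb : -1 < b) (j : ℕ) :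
    IntervalIntegrable
      (fun x : ℝ => ((|x| : ℝ) : ℂ) ^ (2 * k) * (x : ℂ) ^ j * (((1 - x ^ 2) ^ b : ℝ) : ℂ))
      volume (-1) 1 ∧
    ∫ x in (-1 : ℝ)..1,
        ((|x| : ℝ) : ℂ) ^ (2 * k) * (x : ℂ) ^ j * (((1 - x ^ 2) ^ b : ℝ) : ℂ) =
      (1 + (-1) ^ j) / 2 * Complex.betaIntegral (k + (j + 1) / 2) (b + 1) := by
  set u : ℂ := k + (j + 1) / 2 with hu
  have hure : 0 < u.re := by
    have : u.re = k.re + ((j : ℝ) + 1) / 2 := by simp [hu]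
    rw [this]
    have : (0 : ℝ) ≤ j := Nat.cast_nonneg j
    linarith
  obtain ⟨hi, hv⟩ := mellin_beta_half hure hb
  set F : ℝ → ℂ := fun x : ℝ =>
    ((|x| : ℝ) : ℂ) ^ (2 * k) * (x : ℂ) ^ j * (((1 - x ^ 2) ^ b : ℝ) : ℂ) with hF
  have hpos : ∀ x ∈ Set.uIoc (0 : ℝ) 1,
      (x : ℂ) ^ (2 * u - 1) * (((1 - x ^ 2) ^ b : ℝ) : ℂ) = F x := by
    intro x hx
    rw [Set.uIoc_of_le zero_le_one] at hx
    have hxc : (x : ℂ) ≠ 0 := by exact_mod_cast hx.1.ne'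
    rw [hF]
    simp only [abs_of_pos hx.1]
    rw [← Complex.cpow_natCast (x : ℂ) j, ← Complex.cpow_add _ _ hxc, hu]
    ring_nf
  have hneg : ∀ x : ℝ, F (-x) = (-1) ^ j * F x := by
    intro x
    rw [hF]
    simp only [abs_neg, neg_sq, Complex.ofReal_neg]
    rw [neg_pow (x : ℂ)]; ring
  have i1 : IntervalIntegrable F volume 0 1 := hi.congr (fun x hx => hpos x hx)
  have v1 : ∫ x in (0 : ℝ)..1, F x = Complex.betaIntegral u (b + 1) / 2 := by
    rw [← hv]
    exact (intervalIntegral.integral_congr_ae (Filter.Eventually.of_forall hpos)).symm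
  have i0 : IntervalIntegrable F volume (-1) 0 := by
    have h : IntervalIntegrable (fun x => F (-x)) volume 0 1 := by
      simp only [hneg]; exact i1.const_mul _
    rw [IntervalIntegrable.iff_comp_neg] at h
    simpa using h.symm
  have v0 : ∫ x in (-1 : ℝ)..0, F x = (-1) ^ j * (Complex.betaIntegral u (b + 1) / 2) := by
    have h := intervalIntegral.integral_comp_neg (a := 0) (b := 1) F
    rw [neg_zero] at h
    rw [← h]
    simp only [hneg]
    rw [intervalIntegral.integral_const_mul, v1]
  refine ⟨i0.trans i1, ?_⟩
  rw [← intervalIntegral.integral_add_adjacent_intervals i0 i1, v0, v1]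
  ring

theorem abs_mellin_polynomial_integrable {k : ℂ} (hk : -1 / 2 < k.re) {b : ℝ} (hb : -1 < b)
    (p : ℝ[X]) :
    IntervalIntegrable
      (fun x : ℝ => ((|x| : ℝ) : ℂ) ^ (2 * k) * (((1 - x ^ 2) ^ b * p.eval x : ℝ) : ℂ))
      volume (-1) 1 := by
  have h := (abs_mellin_monomial hk hb 0).1
  have hc : ContinuousOn (fun x : ℝ => ((p.eval x : ℝ) : ℂ)) (Set.uIcc (-1) 1) := by
    fun_prop
  refine (h.mul_continuousOn hc).congr fun x _ => ?_
  push_cast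
  ring

/-- The rescaled Mellin transform of `(1 - x²)^b p(x)` is a polynomial in the spectral variable: the
even monomials give Beta integrals whose Gamma factors all cancel up to Pochhammer products, and
the odd ones give zero. -/
theorem exists_polynomial_abs_mellin {b : ℝ} (hb : -1 < b) (n : ℕ) (p : ℝ[X])
    (hp : p.natDegree ≤ 2 * n) :
    ∃ P : ℂ[X], P.natDegree ≤ n ∧ ∀ k : ℂ, -1 / 2 < k.re →
      Complex.Gamma (k + n + b + 3 / 2) / Complex.Gamma (k + 1 / 2) *
        ∫ x in (-1 : ℝ)..1,
          ((|x| : ℝ) : ℂ) ^ (2 * k) * (((1 - x ^ 2) ^ b * p.eval x : ℝ) : ℂ) = P.eval k := by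
  revert hp
  refine Polynomial.induction_with_natDegree_le (fun p : ℝ[X] =>
    ∃ P : ℂ[X], P.natDegree ≤ n ∧ ∀ k : ℂ, -1 / 2 < k.re →
      Complex.Gamma (k + n + b + 3 / 2) / Complex.Gamma (k + 1 / 2) *
        ∫ x in (-1 : ℝ)..1,
          ((|x| : ℝ) : ℂ) ^ (2 * k) * (((1 - x ^ 2) ^ b * p.eval x : ℝ) : ℂ) = P.eval k)
    (2 * n) ?_ ?_ ?_ p
  · exact ⟨0, by simp, fun k _ => by simp⟩
  · intro i r _ hi
    have key : ∀ k : ℂ, -1 / 2 < k.re → ∫ x in (-1 : ℝ)..1,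
        ((|x| : ℝ) : ℂ) ^ (2 * k) * (((1 - x ^ 2) ^ b * (C r * X ^ i : ℝ[X]).eval x : ℝ) : ℂ) =
        r * ((1 + (-1) ^ i) / 2 * Complex.betaIntegral (k + (i + 1) / 2) (b + 1)) := by
      intro k hk
      rw [← (abs_mellin_monomial hk hb i).2, ← intervalIntegral.integral_const_mul]
      congr 1; ext x; simp; ring
    rcases Nat.even_or_odd i with he | ho
    · obtain ⟨j, rfl⟩ := he
      have hj : j ≤ n := by omega
      refine ⟨C ((r : ℂ) * Complex.Gamma (b + 1)) * ((ascPochhammer ℂ j).comp (X + C (1 / 2 : ℂ)) *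
        (ascPochhammer ℂ (n - j)).comp (X + C ((j : ℂ) + b + 3 / 2))), ?_, ?_⟩
      · refine (natDegree_C_mul_le _ _).trans (natDegree_mul_le.trans ?_)
        simp only [natDegree_comp, ascPochhammer_natDegree, natDegree_X_add_C, mul_one]
        omega
      · intro k hk
        rw [key k hk]
        have h1 : 0 < (k + 1 / 2 : ℂ).re := by simp; linarith
        have hjr : (0 : ℝ) ≤ j := Nat.cast_nonneg j
        have h2 : 0 < (k + 1 / 2 + j : ℂ).re := by simp; linarith
        have h3 : 0 < (k + j + b + 3 / 2 : ℂ).re := by simp; linarith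
        have h4 : 0 < (b + 1 : ℂ).re := by simp; linarith
        have hne : ∀ z : ℂ, 0 < z.re → ∀ m : ℕ, z ≠ -m := by
          intro z hz m h
          rw [h] at hz
          simp at hz
          linarith [(Nat.cast_nonneg m : (0 : ℝ) ≤ m)]
        have g1 := Complex.Gamma_add_nat_div_Gamma_eq (n := j) _ (hne _ h1)
        have g2 := Complex.Gamma_add_nat_div_Gamma_eq (n := n - j) _ (hne _ h3)
        have B := Complex.Gamma_mul_Gamma_eq_betaIntegral h2 h4
        have e1 : k + ((j + j : ℕ) + 1) / 2 = k + 1 / 2 + j := by push_cast; ring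
        have e2 : k + j + b + 3 / 2 + (n - j : ℕ) = k + n + b + 3 / 2 := by
          rw [Nat.cast_sub hj]; ring
        have e3 : k + 1 / 2 + j + (b + 1) = k + j + b + 3 / 2 := by ring
        rw [e3] at B
        rw [e2] at g2
        have n1 := Complex.Gamma_ne_zero_of_re_pos h1
        have n3 := Complex.Gamma_ne_zero_of_re_pos h3
        rw [e1]
        simp only [eval_mul, eval_C, eval_comp, eval_add, eval_X]
        rw [← g1, ← add_assoc, ← add_assoc, ← g2]
        have hsgn : (1 + (-1 : ℂ) ^ (j + j)) / 2 = 1 := by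
          rw [Even.neg_one_pow ⟨j, rfl⟩]; norm_num
        rw [hsgn]
        generalize Complex.Gamma (k + 1 / 2) = y₁ at *
        generalize Complex.Gamma (k + 1 / 2 + j) = y₂ at *
        generalize Complex.Gamma (k + j + b + 3 / 2) = y₃ at *
        generalize Complex.Gamma (k + n + b + 3 / 2) = y₄ at *
        generalize Complex.betaIntegral (k + 1 / 2 + j) (b + 1) = y₅ at *
        field_simp
        linear_combination (-y₄ * r) * B
    · refine ⟨0, by simp, fun k hk => ?_⟩
      rw [key k hk, ho.neg_one_pow]
      simp
  · intro f g _ _ ⟨P, hP, hP'⟩ ⟨Q, hQ, hQ'⟩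
    refine ⟨P + Q, natDegree_add_le_of_degree_le hP hQ, fun k hk => ?_⟩
    rw [eval_add, ← hP' k hk, ← hQ' k hk, ← mul_add, ← intervalIntegral.integral_add
      (abs_mellin_polynomial_integrable hk hb f) (abs_mellin_polynomial_integrable hk hb g)]
    congr 2; ext x; simp; ring

/-! ### Monic Gegenbauer polynomials -/

/-- The coefficient `b_n` of the three-term recurrence `x p_n = p_{n+1} + b_n p_{n-1}` of the monic
polynomials orthogonal with respect to `(1 - x²)^a`. -/
noncomputable def gegenbauerCoeff (a : ℝ) (n : ℕ) : ℝ :=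
  n * (n + 2 * a) / ((2 * n + 2 * a + 1) * (2 * n + 2 * a - 1))

/-- The monic orthogonal polynomials for the weight `(1 - x²)^a`, defined by their three-term
recurrence. They are multiples of the Gegenbauer polynomials with parameter `a + 1/2`. -/
noncomputable def monicGegenbauer (a : ℝ) : ℕ → ℝ[X]
  | 0 => 1
  | 1 => X
  | n + 2 => X * monicGegenbauer a (n + 1) - C (gegenbauerCoeff a (n + 1)) * monicGegenbauer a n

namespace monicGegenbauer

variable {a : ℝ}

theorem eval_add_two (a : ℝ) (n : ℕ) (x : ℝ) :
    (monicGegenbauer a (n + 2)).eval x = x * (monicGegenbauer a (n + 1)).eval x -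
      gegenbauerCoeff a (n + 1) * (monicGegenbauer a n).eval x := by
  simp [monicGegenbauer]

theorem monic_and_natDegree (a : ℝ) (n : ℕ) :
    (monicGegenbauer a n).Monic ∧ (monicGegenbauer a n).natDegree = n := by
  induction n using Nat.twoStepInduction with
  | zero => exact ⟨monic_one, natDegree_one⟩
  | one => exact ⟨monic_X, natDegree_X⟩
  | more n h0 h1 =>
    have hX : (X * monicGegenbauer a (n + 1)).Monic := monic_X.mul h1.1
    have hd : (X * monicGegenbauer a (n + 1)).natDegree = n + 2 := by
      rw [monic_X.natDegree_mul h1.1, natDegree_X, h1.2]; omega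
    have hlt : (C (gegenbauerCoeff a (n + 1)) * monicGegenbauer a n).degree <
        (X * monicGegenbauer a (n + 1)).degree := by
      rw [degree_eq_natDegree hX.ne_zero, hd]
      refine degree_le_natDegree.trans_lt ?_
      have := (natDegree_C_mul_le (gegenbauerCoeff a (n + 1)) (monicGegenbauer a n)).trans_eq h0.2
      exact_mod_cast (by omega : _ < n + 2)
    exact ⟨hX.sub_of_left hlt, by
      rw [monicGegenbauer, natDegree_eq_of_degree_eq (degree_sub_eq_left_of_degree_lt hlt), hd]⟩

theorem two_mul_add_one_ne_zero (ha : -1 < a) (ha' : a ≠ -1 / 2) (n : ℕ) :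
    2 * (n : ℝ) + 2 * a + 1 ≠ 0 := by
  rcases Nat.eq_zero_or_pos n with rfl | hn
  · intro h; apply ha'; simp at h; linarith
  · have : (1 : ℝ) ≤ n := by exact_mod_cast hn
    linarith

theorem coeff_succ_mul (ha : -1 < a) (ha' : a ≠ -1 / 2) (n : ℕ) :
    (2 * n + 2 * a + 3) * (2 * n + 2 * a + 1) * gegenbauerCoeff a (n + 1) =
      (n + 1) * (n + 1 + 2 * a) := by
  have h1 := two_mul_add_one_ne_zero ha ha' n
  have h2 : 2 * (n : ℝ) + 2 * a + 3 ≠ 0 := by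
    have : (0 : ℝ) ≤ n := Nat.cast_nonneg n
    linarith
  have e1 : 2 * ((n : ℝ) + 1) + 2 * a + 1 = 2 * n + 2 * a + 3 := by ring
  have e2 : 2 * ((n : ℝ) + 1) + 2 * a - 1 = 2 * n + 2 * a + 1 := by ring
  rw [gegenbauerCoeff]
  push_cast
  rw [e1, e2]
  exact mul_div_cancel₀ _ (mul_ne_zero h2 h1)

theorem coeff_succ_ne_zero (ha : -1 < a) (ha' : a ≠ -1 / 2) (n : ℕ) :
    gegenbauerCoeff a (n + 1) ≠ 0 := by
  intro h
  have h1 := coeff_succ_mul ha ha' n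
  rw [h, mul_zero] at h1
  have h2 : (n : ℝ) + 1 ≠ 0 := by positivity
  have h3 : (n : ℝ) + 1 + 2 * a = 0 := by
    rcases mul_eq_zero.1 h1.symm with h | h
    · exact absurd h h2
    · exact h
  rcases Nat.eq_zero_or_pos n with rfl | hn
  · apply ha'; simp at h3; linarith
  · have : (1 : ℝ) ≤ n := by exact_mod_cast hn
    linarith

/-- The lowering and raising relations for the first derivative; through the three-term recurrence
either one turns into the other. -/
theorem eval_derivative (ha : -1 < a) (ha' : a ≠ -1 / 2) (n : ℕ) (x : ℝ) :
    (1 - x ^ 2) * (derivative (monicGegenbauer a n)).eval x =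
        (n + 2 * a + 1) * x * (monicGegenbauer a n).eval x -
          (2 * n + 2 * a + 1) * (monicGegenbauer a (n + 1)).eval x ∧
      (1 - x ^ 2) * (derivative (monicGegenbauer a (n + 1))).eval x =
        -(n + 1) * x * (monicGegenbauer a (n + 1)).eval x +
          (2 * n + 2 * a + 3) * gegenbauerCoeff a (n + 1) * (monicGegenbauer a n).eval x := by
  induction n with
  | zero =>
    have h := coeff_succ_mul ha ha' 0
    have h0 := two_mul_add_one_ne_zero ha ha' 0
    have h' : (2 * a + 3) * gegenbauerCoeff a 1 = 1 := by
      apply mul_right_cancel₀ h0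
      push_cast at h ⊢
      simp only [zero_add] at h
      linear_combination h
    constructor
    · simp [monicGegenbauer]
    · simp [monicGegenbauer]
      linear_combination -h'
  | succ n ih =>
    obtain ⟨i1, i2⟩ := ih
    have h1 := coeff_succ_mul ha ha' n
    have h2 := coeff_succ_mul ha ha' (n + 1)
    have h0 := two_mul_add_one_ne_zero ha ha' (n + 1)
    have r := eval_add_two a n x
    have d : (derivative (monicGegenbauer a (n + 2))).eval x =
        (monicGegenbauer a (n + 1)).eval x +
          x * (derivative (monicGegenbauer a (n + 1))).eval x -
          gegenbauerCoeff a (n + 1) * (derivative (monicGegenbauer a n)).eval x := by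
      simp [monicGegenbauer]
    have h3 : (2 * (n + 1 : ℕ) + 2 * a + 3) * gegenbauerCoeff a (n + 2) =
        1 + gegenbauerCoeff a (n + 1) * (2 * n + 2 * a + 1) := by
      apply mul_right_cancel₀ h0
      push_cast at h2 ⊢
      linear_combination h2 - h1
    constructor
    · rw [i2, r]; push_cast; ring
    · rw [d, h3, r]
      push_cast
      linear_combination x * i2 - gegenbauerCoeff a (n + 1) * i1
end monicGegenbauer

/-! ### Orthogonality from Pearson's equation -/

/-- Pearson equation of the weight `(1 - x²)^a`, for a linear functional on polynomials: the
integral of the derivative of `(1 - x²)^(a+1) q(x)` vanishes. -/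
def IsPearson (a : ℝ) (L : ℝ[X] →ₗ[ℝ] ℝ) : Prop :=
  ∀ q : ℝ[X], L ((1 - X ^ 2) * derivative q) = 2 * (a + 1) * L (X * q)

namespace IsPearson

variable {a : ℝ} {L : ℝ[X] →ₗ[ℝ] ℝ}

open monicGegenbauer

theorem map_C_mul (L : ℝ[X] →ₗ[ℝ] ℝ) (r : ℝ) (p : ℝ[X]) : L (C r * p) = r * L p := by
  rw [← smul_eq_C_mul, map_smul, smul_eq_mul]

theorem map_mul_X_mul (L : ℝ[X] →ₗ[ℝ] ℝ) (n : ℕ) (q : ℝ[X]) :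
    L (q * (X * monicGegenbauer a (n + 1))) = L (q * monicGegenbauer a (n + 2)) +
      gegenbauerCoeff a (n + 1) * L (q * monicGegenbauer a n) := by
  rw [← map_C_mul, ← map_add, monicGegenbauer]
  congr 1; ring

theorem map_succ_eq_zero (hL : IsPearson a L) (ha : -1 < a) (ha' : a ≠ -1 / 2) (n : ℕ) :
    L (monicGegenbauer a (n + 1)) = 0 := by
  -- Pearson's equation for `q = p_n` together with the raising relation
  have key : ∀ n : ℕ, (n - 1) * L (X * monicGegenbauer a n) =
      (2 * n + 2 * a + 1) * L (monicGegenbauer a (n + 1)) := by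
    intro n
    have h := hL (monicGegenbauer a n)
    have e : (1 - X ^ 2) * derivative (monicGegenbauer a n) =
        C (n + 2 * a + 1) * (X * monicGegenbauer a n) -
          C (2 * n + 2 * a + 1) * monicGegenbauer a (n + 1) := by
      refine Polynomial.funext fun x => ?_
      have := (eval_derivative ha ha' n x).1
      simp only [eval_mul, eval_sub, eval_one, eval_pow, eval_X, eval_C]
      linear_combination this
    rw [e, map_sub, map_C_mul, map_C_mul] at h
    linear_combination h
  induction n using Nat.twoStepInduction with
  | zero =>
    have h := key 0
    simp only [monicGegenbauer, Nat.cast_zero, mul_one] at h ⊢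
    have : (2 * a + 2) * L X = 0 := by linear_combination -h
    rcases mul_eq_zero.1 this with h | h
    · linarith
    · exact h
  | one =>
    have h := key 1
    have h0 := two_mul_add_one_ne_zero ha ha' 1
    simp only [Nat.cast_one, sub_self, zero_mul] at h h0
    exact (mul_eq_zero.1 h.symm).resolve_left h0
  | more n h1 _ =>
    have h := key (n + 2)
    have r := map_mul_X_mul (a := a) L (n + 1) 1
    simp only [one_mul] at r
    rw [r, h1] at h
    have h0 : (n : ℝ) + 2 * a + 4 ≠ 0 := by
      have : (0 : ℝ) ≤ n := Nat.cast_nonneg n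
      linarith
    apply (mul_eq_zero.1 (?_ : ((n : ℝ) + 2 * a + 4) * _ = 0)).resolve_left h0
    push_cast at h
    linear_combination -h

theorem map_X_pow_mul_eq_zero (hL : IsPearson a L) (ha : -1 < a) (ha' : a ≠ -1 / 2) (j : ℕ) :
    ∀ n, j < n → L (X ^ j * monicGegenbauer a n) = 0 := by
  induction j with
  | zero =>
    intro n hn
    obtain ⟨m, rfl⟩ := Nat.exists_eq_succ_of_ne_zero hn.ne'
    simpa using hL.map_succ_eq_zero ha ha' m
  | succ j ih =>
    intro n hn
    obtain ⟨m, rfl⟩ := Nat.exists_eq_succ_of_ne_zero (by omega : n ≠ 0)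
    have h := map_mul_X_mul (a := a) L m (X ^ j)
    rw [ih (m + 2) (by omega), ih m (by omega)] at h
    rw [pow_succ, mul_assoc, h]; simp

theorem map_mul_eq_zero_of_natDegree_lt (hL : IsPearson a L) (ha : -1 < a) (ha' : a ≠ -1 / 2)
    {q : ℝ[X]} {n : ℕ} (hq : q.natDegree < n) : L (q * monicGegenbauer a n) = 0 := by
  rw [q.as_sum_range_C_mul_X_pow, Finset.sum_mul, map_sum]
  refine Finset.sum_eq_zero fun i hi => ?_
  rw [mul_assoc, map_C_mul, hL.map_X_pow_mul_eq_zero ha ha' i n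
    (by have := Finset.mem_range.1 hi; omega), mul_zero]

theorem orthogonal (hL : IsPearson a L) (ha : -1 < a) (ha' : a ≠ -1 / 2) {m n : ℕ} (h : m ≠ n) :
    L (monicGegenbauer a m * monicGegenbauer a n) = 0 := by
  rcases lt_or_gt_of_ne h with h | h
  · exact hL.map_mul_eq_zero_of_natDegree_lt ha ha' (by rwa [(monic_and_natDegree a m).2])
  · rw [mul_comm]
    exact hL.map_mul_eq_zero_of_natDegree_lt ha ha' (by rwa [(monic_and_natDegree a n).2])

theorem map_X_mul_mul_succ (hL : IsPearson a L) (ha : -1 < a) (ha' : a ≠ -1 / 2) (n : ℕ) :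
    L (X * (monicGegenbauer a n * monicGegenbauer a (n + 1))) =
      L (monicGegenbauer a (n + 1) * monicGegenbauer a (n + 1)) := by
  cases n with
  | zero => simp [monicGegenbauer]
  | succ n =>
    have h := map_mul_X_mul (a := a) L n (monicGegenbauer a (n + 2))
    rw [hL.orthogonal ha ha' (by omega : n + 2 ≠ n), mul_zero, add_zero] at h
    rw [← h]; congr 1; ring

theorem map_sq_succ (hL : IsPearson a L) (ha : -1 < a) (ha' : a ≠ -1 / 2) (n : ℕ) :
    L (monicGegenbauer a (n + 1) * monicGegenbauer a (n + 1)) =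
      gegenbauerCoeff a (n + 1) * L (monicGegenbauer a n * monicGegenbauer a n) := by
  rw [← hL.map_X_mul_mul_succ ha ha']
  have h := map_mul_X_mul (a := a) L n (monicGegenbauer a n)
  rw [hL.orthogonal ha ha' (by omega : n ≠ n + 2), zero_add] at h
  rw [← h]; congr 1; ring

theorem map_sq_ne_zero (hL : IsPearson a L) (ha : -1 < a) (ha' : a ≠ -1 / 2) (h1 : L 1 ≠ 0)
    (n : ℕ) : L (monicGegenbauer a n * monicGegenbauer a n) ≠ 0 := by
  induction n with
  | zero => simpa [monicGegenbauer] using h1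
  | succ n ih =>
    rw [hL.map_sq_succ ha ha']
    exact mul_ne_zero (coeff_succ_ne_zero ha ha' n) ih

/-- Moment form of a first-order differential relation `(1 - x²) F' = 2 a x F + G`, obtained from
Pearson's equation for `q = x^(n+1) F`. -/
theorem moment_relation (hL : IsPearson a L) {F G : ℝ[X]}
    (hFG : ∀ x : ℝ, (1 - x ^ 2) * (derivative F).eval x = 2 * a * x * F.eval x + G.eval x)
    (n : ℕ) :
    (n + 1) * L (X ^ n * F) - (n + 3) * L (X ^ (n + 2) * F) + L (X ^ (n + 1) * G) = 0 := by
  have h := hL (X ^ (n + 1) * F)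
  have e : (1 - X ^ 2) * derivative (X ^ (n + 1) * F) =
      C ((n : ℝ) + 1) * (X ^ n * F) - C ((n : ℝ) + 1) * (X ^ (n + 2) * F) +
        (C (2 * a) * (X * (X ^ (n + 1) * F)) + X ^ (n + 1) * G) := by
    refine Polynomial.funext fun x => ?_
    simp only [derivative_mul, derivative_X_pow, eval_mul, eval_sub, eval_one, eval_pow, eval_X,
      eval_C, eval_add, Nat.add_sub_cancel]
    push_cast
    linear_combination x ^ (n + 1) * hFG x
  have e' : X * (X ^ (n + 1) * F) = X ^ (n + 2) * F := by ring
  rw [e] at h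
  rw [L.map_add, L.map_sub, L.map_add, map_C_mul, map_C_mul, map_C_mul, e'] at h
  linear_combination h

theorem moment_relation_zero (hL : IsPearson a L) {F G : ℝ[X]}
    (hFG : ∀ x : ℝ, (1 - x ^ 2) * (derivative F).eval x = 2 * a * x * F.eval x + G.eval x) :
    L G = 2 * L (X * F) := by
  have h := hL F
  have e : (1 - X ^ 2) * derivative F = C (2 * a) * (X * F) + G := by
    refine Polynomial.funext fun x => ?_
    simp only [eval_mul, eval_sub, eval_one, eval_pow, eval_X, eval_C, eval_add]
    linear_combination hFG x
  rw [e, map_add, map_C_mul] at h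
  linear_combination h

end IsPearson

/-! ### The Christoffel-Darboux kernel and its moments -/

/-- The Wronskian `p_{n+1}' p_n - p_{n+1} p_n'`, which by the confluent Christoffel-Darboux formula
is a multiple of the kernel `∑_{j ≤ n} p_j² / h_j`. -/
noncomputable def gegenbauerWronskian (a : ℝ) (n : ℕ) : ℝ[X] :=
  derivative (monicGegenbauer a (n + 1)) * monicGegenbauer a n -
    monicGegenbauer a (n + 1) * derivative (monicGegenbauer a n)

/-- The even moments `L[x^{2k} (1 - x²) W(x)]` of the Wronskian. -/
noncomputable def wronskianMoment (a : ℝ) (n : ℕ) (L : ℝ[X] →ₗ[ℝ] ℝ) (k : ℕ) : ℝ :=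
  L (X ^ (2 * k) * ((1 - X ^ 2) * gegenbauerWronskian a n))

namespace IsPearson

variable {a : ℝ} {L : ℝ[X] →ₗ[ℝ] ℝ}

open monicGegenbauer

theorem christoffelDarboux (hL : IsPearson a L) (ha : -1 < a) (ha' : a ≠ -1 / 2) (h1 : L 1 ≠ 0)
    (n : ℕ) (x : ℝ) :
    ∑ j ∈ Finset.range (n + 1), (monicGegenbauer a j).eval x ^ 2 /
        L (monicGegenbauer a j * monicGegenbauer a j) =
      (gegenbauerWronskian a n).eval x / L (monicGegenbauer a n * monicGegenbauer a n) := by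
  induction n with
  | zero => simp [gegenbauerWronskian, monicGegenbauer]
  | succ n ih =>
    have h0 := hL.map_sq_ne_zero ha ha' h1 n
    have hb := coeff_succ_ne_zero ha ha' n
    rw [Finset.sum_range_succ, ih, hL.map_sq_succ ha ha' n]
    field_simp
    simp only [gegenbauerWronskian, monicGegenbauer, derivative_sub, derivative_mul, derivative_X,
      derivative_C, eval_sub, eval_mul, eval_add, eval_X, eval_C, zero_mul, zero_add,
      one_mul]
    ring

/-- The base value `2 c h_{n+1}`, written with `h_{n+1} = b_{n+1} h_n`. -/
theorem wronskianMoment_zero (hL : IsPearson a L) (ha : -1 < a) (ha' : a ≠ -1 / 2) (n : ℕ) :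
    wronskianMoment a n L 0 = 2 * (a + (n + 1)) * (gegenbauerCoeff a (n + 1) *
      L (monicGegenbauer a n * monicGegenbauer a n)) := by
  have e : X ^ (2 * 0) * ((1 - X ^ 2) * gegenbauerWronskian a n) =
      C (2 * n + 2 * a + 1) * (monicGegenbauer a (n + 1) * monicGegenbauer a (n + 1)) +
      C ((2 * n + 2 * a + 3) * gegenbauerCoeff a (n + 1)) *
        (monicGegenbauer a n * monicGegenbauer a n) -
      C (2 * (a + (n + 1))) * (X * (monicGegenbauer a n * monicGegenbauer a (n + 1))) := by
    refine Polynomial.funext fun x => ?_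
    obtain ⟨i1, i2⟩ := eval_derivative ha ha' n x
    simp only [gegenbauerWronskian, eval_mul, eval_sub, eval_one, eval_pow, eval_X, eval_C,
      eval_add]
    linear_combination (monicGegenbauer a n).eval x * i2 - (monicGegenbauer a (n + 1)).eval x * i1
  rw [wronskianMoment, e, map_sub, map_add, map_C_mul, map_C_mul, map_C_mul,
    hL.map_X_mul_mul_succ ha ha', hL.map_sq_succ ha ha']
  ring

/-- Three-term recurrence for the moments of the Wronskian. The products `u²`, `uv`, `v²` with
`u = p_{n+1}`, `v = p_n` satisfy a closed first-order system, whose moment form is eliminated down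
to one unknown. -/
theorem wronskianMoment_recurrence (hL : IsPearson a L) (ha : -1 < a) (ha' : a ≠ -1 / 2)
    (n k : ℕ) :
    (k + 2) * ((k + 3 / 2) ^ 2 - (a + (n + 1)) ^ 2) * wronskianMoment a n L (k + 1) +
        k * ((k : ℝ) ^ 2 - 1 / 4) * wronskianMoment a n L (k - 1) =
      (k + 1 / 2) * (2 * (k + 1) ^ 2 + a ^ 2 - (a + (n + 1)) ^ 2) * wronskianMoment a n L k := by
  set u := monicGegenbauer a (n + 1) with hu
  set v := monicGegenbauer a n with hv
  set c : ℝ := a + (n + 1) with hc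
  set γ : ℝ := (2 * n + 2 * a + 3) * gegenbauerCoeff a (n + 1) with hγ
  set δ : ℝ := 2 * n + 2 * a + 1 with hδ
  have hγδ : γ * δ = c ^ 2 - a ^ 2 := by
    have := coeff_succ_mul ha ha' n
    rw [hγ, hδ, hc]; linear_combination this
  have du : ∀ x : ℝ, (1 - x ^ 2) * (derivative u).eval x =
      -(n + 1) * x * u.eval x + γ * v.eval x := fun x => (eval_derivative ha ha' n x).2
  have dv : ∀ x : ℝ, (1 - x ^ 2) * (derivative v).eval x =
      (n + 2 * a + 1) * x * v.eval x - δ * u.eval x := fun x => (eval_derivative ha ha' n x).1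
  set P : ℝ[X] := u * v with hP
  set S : ℝ[X] := C δ * (u * u) + C γ * (v * v) with hS
  set D : ℝ[X] := C γ * (v * v) - C δ * (u * u) with hD
  have dP : ∀ x : ℝ, (1 - x ^ 2) * (derivative P).eval x = 2 * a * x * P.eval x + D.eval x := by
    intro x
    simp only [hP, hD, derivative_mul, eval_add, eval_sub, eval_mul, eval_C]
    linear_combination v.eval x * du x + u.eval x * dv x
  have dS : ∀ x : ℝ, (1 - x ^ 2) * (derivative S).eval x =
      2 * a * x * S.eval x + (C (2 * c) * (X * D)).eval x := by
    intro x
    simp only [hS, hD, derivative_add, derivative_mul, derivative_C, eval_add, eval_sub, eval_mul,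
      eval_C, eval_X, eval_zero]
    linear_combination 2 * δ * u.eval x * du x + 2 * γ * v.eval x * dv x
  have dD : ∀ x : ℝ, (1 - x ^ 2) * (derivative D).eval x =
      2 * a * x * D.eval x + (C (2 * c) * (X * S) - C (4 * (γ * δ)) * P).eval x := by
    intro x
    simp only [hS, hD, hP, derivative_sub, derivative_mul, derivative_C, eval_add, eval_sub,
      eval_mul, eval_C, eval_X, eval_zero]
    linear_combination 2 * γ * v.eval x * dv x - 2 * δ * u.eval x * du x
  have hW : ∀ k, wronskianMoment a n L k =
      L (X ^ (2 * k) * S) - 2 * c * L (X ^ (2 * k + 1) * P) := by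
    intro k
    rw [wronskianMoment, ← map_C_mul, ← map_sub]
    congr 1
    refine Polynomial.funext fun x => ?_
    simp only [gegenbauerWronskian, ← hu, ← hv, hS, hP, eval_mul, eval_sub, eval_one, eval_pow,
      eval_X, eval_C, eval_add]
    linear_combination x ^ (2 * k) * (v.eval x * du x - u.eval x * dv x)
  -- moment forms of the three differential relations
  have r1 : ∀ k : ℕ, (2 * k + 2) * L (X ^ (2 * k + 1) * P) - (2 * k + 4) *
      L (X ^ (2 * k + 3) * P) + L (X ^ (2 * k + 2) * D) = 0 := by
    intro k
    have h := hL.moment_relation dP (2 * k + 1)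
    push_cast at h
    linear_combination h
  have r1' : L D = 2 * L (X * P) := hL.moment_relation_zero dP
  have r2 : ∀ k : ℕ, (2 * k + 1) * L (X ^ (2 * k) * S) - (2 * k + 3) * L (X ^ (2 * k + 2) * S) +
      2 * c * L (X ^ (2 * k + 2) * D) = 0 := by
    intro k
    have h := hL.moment_relation dS (2 * k)
    have e : X ^ (2 * k + 1) * (C (2 * c) * (X * D)) = C (2 * c) * (X ^ (2 * k + 2) * D) := by
      ring
    rw [e, map_C_mul] at h
    push_cast at h
    exact h
  have r3 : ∀ k : ℕ, (2 * k + 1) * L (X ^ (2 * k) * D) - (2 * k + 3) * L (X ^ (2 * k + 2) * D) +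
      2 * c * L (X ^ (2 * k + 2) * S) - 4 * (γ * δ) * L (X ^ (2 * k + 1) * P) = 0 := by
    intro k
    have h := hL.moment_relation dD (2 * k)
    have e : X ^ (2 * k + 1) * (C (2 * c) * (X * S) - C (4 * (γ * δ)) * P) =
        C (2 * c) * (X ^ (2 * k + 2) * S) - C (4 * (γ * δ)) * (X ^ (2 * k + 1) * P) := by
      ring
    rw [e, map_sub, map_C_mul, map_C_mul] at h
    push_cast at h
    linear_combination h
  -- the moments of `S` are proportional to those of `x P`
  have r4 : ∀ k : ℕ, (2 * k + 1) * L (X ^ (2 * k) * S) =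
      2 * c * (2 * k + 2) * L (X ^ (2 * k + 1) * P) := by
    intro k
    induction k with
    | zero =>
      have hXP : L (X * P) = L (u * u) := by
        rw [hP, mul_comm u v]; exact hL.map_X_mul_mul_succ ha ha' n
      have hsq : L (u * u) = gegenbauerCoeff a (n + 1) * L (v * v) := hL.map_sq_succ ha ha' n
      have hS0 : L S = δ * L (u * u) + γ * L (v * v) := by
        rw [hS, map_add, map_C_mul, map_C_mul]
      simp only [mul_zero, pow_zero, one_mul, zero_add, pow_one, Nat.cast_zero]
      rw [hS0, hXP, hsq, hγ, hδ, hc]; ring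
    | succ k ih =>
      have h1 := r1 k
      have h2 := r2 k
      have e1 : 2 * (k + 1) = 2 * k + 2 := by ring
      have e2 : 2 * k + 2 + 1 = 2 * k + 3 := by ring
      rw [e1, e2]
      push_cast
      linear_combination ih + 2 * c * h1 - h2
  have hM : ∀ k : ℕ, (2 * k + 1) * wronskianMoment a n L k = 2 * c * L (X ^ (2 * k + 1) * P) := by
    intro k
    rw [hW]; linear_combination r4 k
  have hMS : ∀ k : ℕ, L (X ^ (2 * k) * S) = (2 * k + 2) * wronskianMoment a n L k := by
    intro k
    rw [hW]
    linear_combination -r4 k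
  have h3 := r3 k
  have h1 := r1 k
  have e1 : 2 * (k + 1) = 2 * k + 2 := by ring
  have hS1 := hMS (k + 1)
  have m1 := hM (k + 1)
  have m0 := hM k
  rw [e1] at hS1 m1
  push_cast at hS1 m1
  cases k with
  | zero =>
    simp only [mul_zero, pow_zero, one_mul, zero_add, Nat.cast_zero, pow_one] at *
    linear_combination (-c / 4) * h3 - (3 * c / 4) * h1 + (c / 4) * r1' + (c ^ 2 / 2) * hS1 +
      (3 / 2) * m1 - ((8 - 4 * (γ * δ)) / 8) * m0 - (wronskianMoment a n L 0 / 2) * hγδ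
  | succ k =>
    have h1' := r1 k
    have mm := hM k
    have e4 : 2 * (k + 1) = 2 * k + 2 := by ring
    simp only [e4, Nat.add_sub_cancel] at *
    push_cast at *
    linear_combination (-c / 4) * h3 - ((2 * k + 5) * c / 4) * h1 + ((2 * k + 3) * c / 4) * h1' +
      (c ^ 2 / 2) * hS1 + ((2 * k + 5) * (2 * k + 6) / 8) * m1 -
      (((2 * k + 4) * (4 * k + 8) - 4 * (γ * δ)) / 8) * m0 +
      ((2 * k + 3) * (2 * k + 2) / 8) * mm -
      ((2 * k + 3) * wronskianMoment a n L (k + 1) / 2) * hγδ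

end IsPearson

/-! ### The symmetric Jacobi weight -/

theorem jacobiWeight_symm (a x : ℝ) :
    jacobiWeight a a x = (Set.Ioo (-1 : ℝ) 1).indicator (fun t => (1 - t ^ 2) ^ a) x := by
  unfold jacobiWeight
  by_cases hx : x ∈ Set.Ioo (-1 : ℝ) 1
  · rw [Set.indicator_of_mem hx, Set.indicator_of_mem hx,
      ← Real.mul_rpow (by linarith [hx.2]) (by linarith [hx.1])]
    ring_nf
  · rw [Set.indicator_of_notMem hx, Set.indicator_of_notMem hx]

theorem jacobiWeight_symm_mul (a x : ℝ) (p : ℝ[X]) :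
    jacobiWeight a a x * p.eval x =
      (Set.Ioo (-1 : ℝ) 1).indicator (fun t => (1 - t ^ 2) ^ a * p.eval t) x := by
  rw [jacobiWeight_symm]
  exact (Set.indicator_mul_left (Set.Ioo (-1 : ℝ) 1) (fun t => (1 - t ^ 2) ^ a)
    fun t => p.eval t).symm

theorem intervalIntegrable_one_sub_sq_rpow_mul {a : ℝ} (ha : -1 < a) (p : ℝ[X]) :
    IntervalIntegrable (fun x : ℝ => (1 - x ^ 2) ^ a * p.eval x) volume (-1) 1 := by
  have h := abs_mellin_polynomial_integrable (k := 0) (by norm_num) ha p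
  rw [intervalIntegrable_iff] at h ⊢
  refine (Integrable.re h).congr (Filter.Eventually.of_forall fun x => ?_)
  simp only [mul_zero, Complex.cpow_zero, one_mul]
  exact Complex.ofReal_re _

theorem integrable_jacobiWeight_mul {a : ℝ} (ha : -1 < a) (p : ℝ[X]) :
    Integrable (fun x => jacobiWeight a a x * p.eval x) := by
  simp only [jacobiWeight_symm_mul]
  rw [integrable_indicator_iff measurableSet_Ioo,
    ← intervalIntegrable_iff_integrableOn_Ioo_of_le (by norm_num)]
  exact intervalIntegrable_one_sub_sq_rpow_mul ha p

theorem integral_jacobiWeight_mul (a : ℝ) (p : ℝ[X]) :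
    ∫ x, jacobiWeight a a x * p.eval x = ∫ x in (-1 : ℝ)..1, (1 - x ^ 2) ^ a * p.eval x := by
  simp only [jacobiWeight_symm_mul]
  rw [integral_indicator measurableSet_Ioo, intervalIntegral.integral_of_le (by norm_num),
    integral_Ioc_eq_integral_Ioo]

/-- Integration of polynomials against the symmetric Jacobi weight. -/
noncomputable def jacobiFunctional {a : ℝ} (ha : -1 < a) : ℝ[X] →ₗ[ℝ] ℝ where
  toFun p := ∫ x, jacobiWeight a a x * p.eval x
  map_add' p q := by
    simp only [eval_add, mul_add]
    exact integral_add (integrable_jacobiWeight_mul ha p) (integrable_jacobiWeight_mul ha q)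
  map_smul' r p := by
    simp only [eval_smul, smul_eq_mul, RingHom.id_apply]
    rw [← integral_const_mul]
    congr 1; ext x; ring

theorem jacobiFunctional_apply {a : ℝ} (ha : -1 < a) (p : ℝ[X]) :
    jacobiFunctional ha p = ∫ x, jacobiWeight a a x * p.eval x := rfl

theorem jacobiFunctional_one_pos {a : ℝ} (ha : -1 < a) : 0 < jacobiFunctional ha 1 := by
  rw [jacobiFunctional_apply, integral_jacobiWeight_mul]
  refine intervalIntegral.intervalIntegral_pos_of_pos_on
    (intervalIntegrable_one_sub_sq_rpow_mul ha 1) (fun x hx => ?_) (by norm_num)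
  have : 0 < 1 - x ^ 2 := by nlinarith [hx.1, hx.2]
  simp only [eval_one, mul_one]
  positivity

theorem isPearson_jacobiFunctional {a : ℝ} (ha : -1 < a) :
    IsPearson a (jacobiFunctional ha) := by
  intro q
  have hd : ∀ x ∈ Set.Ioo (-1 : ℝ) 1, HasDerivAt (fun x => (1 - x ^ 2) ^ (a + 1) * q.eval x)
      ((1 - x ^ 2) ^ a * ((1 - X ^ 2) * derivative q - C (2 * (a + 1)) * (X * q)).eval x) x := by
    intro x hx
    have hs : 0 < 1 - x ^ 2 := by nlinarith [hx.1, hx.2]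
    have h1 : HasDerivAt (fun x : ℝ => 1 - x ^ 2) (-(2 * x)) x := by
      simpa using (hasDerivAt_pow 2 x).const_sub 1
    have h2 := (h1.rpow_const (p := a + 1) (Or.inl hs.ne')).mul (q.hasDerivAt x)
    convert! h2 using 1
    simp only [eval_sub, eval_mul, eval_one, eval_pow, eval_X, eval_C, add_sub_cancel_right]
    rw [Real.rpow_add_one hs.ne']
    ring
  have hc : ContinuousOn (fun x : ℝ => (1 - x ^ 2) ^ (a + 1) * q.eval x) (Set.Icc (-1) 1) := by
    refine ContinuousOn.mul (ContinuousOn.rpow_const (by fun_prop) fun x _ => Or.inr (by linarith))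
      (by fun_prop)
  have h := intervalIntegral.integral_eq_sub_of_hasDerivAt_of_le (by norm_num) hc hd
    (intervalIntegrable_one_sub_sq_rpow_mul ha _)
  rw [← integral_jacobiWeight_mul, ← jacobiFunctional_apply ha] at h
  have h0 : (0 : ℝ) ^ (a + 1) = 0 := Real.zero_rpow (by linarith)
  rw [map_sub, IsPearson.map_C_mul, one_pow, neg_one_sq, sub_self, h0] at h
  linarith

/-! ### The one-point density -/

/-- The joint density is the product of the weights times the squared determinant of the values of
any monic polynomial basis. -/
theorem jacobiJoint_two_eq_det {p : ℕ → ℝ[X]} (hm : ∀ n, (p n).Monic)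
    (hd : ∀ n, (p n).natDegree = n) (a : ℝ) (n : ℕ) (x : Fin n → ℝ) :
    jacobiJoint 2 a a n x = (∏ l, jacobiWeight a a (x l)) *
      (∑ σ : Equiv.Perm (Fin n), ((Equiv.Perm.sign σ : ℤ) : ℝ) *
        ∏ i, (p (σ i)).eval (x i)) ^ 2 := by
  have h := Matrix.det_eval_matrixOfPolynomials_eq_det_vandermonde x (fun i : Fin n => p i)
    (fun i => hd i) (fun i => hm i)
  rw [Matrix.det_vandermonde, ← Matrix.det_transpose, Matrix.det_apply'] at h
  simp only [Matrix.transpose_apply, Matrix.of_apply] at h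
  rw [jacobiJoint, ← h, ← Finset.prod_pow]
  simp only [Real.rpow_two, sq_abs, Finset.prod_pow]

/-- The integrand of the one-point density contains the squared Vandermonde determinant of the points
`x, y_l`. -/
theorem prod_sq_mul_jacobiJoint_two {p : ℕ → ℝ[X]} (hm : ∀ n, (p n).Monic)
    (hd : ∀ n, (p n).natDegree = n) (a : ℝ) (n : ℕ) (x : ℝ) (y : Fin n → ℝ) :
    (∏ l, |x - y l| ^ (2 : ℝ)) * jacobiJoint 2 a a n y = (∏ l, jacobiWeight a a (y l)) *
      (∑ σ : Equiv.Perm (Fin (n + 1)), ((Equiv.Perm.sign σ : ℤ) : ℝ) *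
        ((p (σ 0)).eval x * ∏ i : Fin n, (p (σ i.succ)).eval (y i))) ^ 2 := by
  have h := Matrix.det_eval_matrixOfPolynomials_eq_det_vandermonde (Fin.cons x y : Fin (n + 1) → ℝ)
    (fun i : Fin (n + 1) => p i) (fun i => hd i) (fun i => hm i)
  rw [Matrix.det_vandermonde, ← Matrix.det_transpose, Matrix.det_apply'] at h
  simp only [Matrix.transpose_apply, Matrix.of_apply, Fin.prod_univ_succ, Fin.cons_zero,
    Fin.cons_succ, Fin.prod_Ioi_zero, Fin.prod_Ioi_succ] at h
  rw [jacobiJoint, ← h]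
  simp only [Real.rpow_two, sq_abs, mul_pow, ← Finset.prod_pow]
  rw [mul_left_comm]
  congr 2
  exact Finset.prod_congr rfl fun l _ => by ring

section Determinantal

variable {a : ℝ} {p : ℕ → ℝ[X]} {h : ℕ → ℝ}

theorem integrable_prod_jacobiWeight (ha : -1 < a) {n m : ℕ} (s t : Fin n → Fin m) :
    Integrable fun y : Fin n → ℝ => ∏ l, (jacobiWeight a a (y l) *
      (p (s l) * p (t l)).eval (y l)) :=
  Integrable.fintype_prod (f := fun l z => jacobiWeight a a z * (p (s l) * p (t l)).eval z)
    fun _ => integrable_jacobiWeight_mul ha _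

theorem integral_prod_jacobiWeight (ha : -1 < a)
    (hp : ∀ i j, jacobiFunctional ha (p i * p j) = if i = j then h i else 0) {n m : ℕ}
    (s t : Fin n → Fin m) :
    ∫ y : Fin n → ℝ, ∏ l, (jacobiWeight a a (y l) * (p (s l) * p (t l)).eval (y l)) =
      if s = t then ∏ l, h (s l) else 0 := by
  rw [integral_fintype_prod_volume_eq_prod
    (fun l z => jacobiWeight a a z * (p (s l) * p (t l)).eval z)]
  simp only [← jacobiFunctional_apply ha, hp]
  split_ifs with hst
  · subst hst; simp
  · obtain ⟨l, hl⟩ := Function.ne_iff.1 hst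
    refine Finset.prod_eq_zero (Finset.mem_univ l) (if_neg fun e => hl (Fin.ext e))

/-- Integrating the square of an antisymmetrised product of orthogonal polynomials: by
orthogonality only the pairs of permutations with the same indices survive. -/
theorem integral_sq_sum_perm (ha : -1 < a)
    (hp : ∀ i j, jacobiFunctional ha (p i * p j) = if i = j then h i else 0) {n m : ℕ}
    (e : Fin n → Fin m)
    (he : ∀ σ τ : Equiv.Perm (Fin m), (fun i => σ (e i)) = (fun i => τ (e i)) → σ = τ)
    (f : Equiv.Perm (Fin m) → ℝ) :
    ∫ y : Fin n → ℝ, (∏ l, jacobiWeight a a (y l)) *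
      (∑ σ : Equiv.Perm (Fin m), ((Equiv.Perm.sign σ : ℤ) : ℝ) *
        (f σ * ∏ i, (p (σ (e i))).eval (y i))) ^ 2 =
      ∑ σ : Equiv.Perm (Fin m), f σ ^ 2 * ∏ i, h (σ (e i)) := by
  have expand : ∀ y : Fin n → ℝ, (∏ l, jacobiWeight a a (y l)) *
      (∑ σ : Equiv.Perm (Fin m), ((Equiv.Perm.sign σ : ℤ) : ℝ) *
        (f σ * ∏ i, (p (σ (e i))).eval (y i))) ^ 2 =
      ∑ σ : Equiv.Perm (Fin m), ∑ τ : Equiv.Perm (Fin m),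
        (((Equiv.Perm.sign σ : ℤ) : ℝ) * ((Equiv.Perm.sign τ : ℤ) : ℝ) * (f σ * f τ)) *
        ∏ l, (jacobiWeight a a (y l) * (p (σ (e l)) * p (τ (e l))).eval (y l)) := by
    intro y
    rw [sq, Finset.sum_mul_sum, Finset.mul_sum]
    refine Finset.sum_congr rfl fun σ _ => ?_
    rw [Finset.mul_sum]
    refine Finset.sum_congr rfl fun τ _ => ?_
    simp only [eval_mul, Finset.prod_mul_distrib]
    ring
  simp only [expand]
  rw [integral_finsetSum _ fun σ _ => integrable_finsetSum _ fun τ _ =>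
    (integrable_prod_jacobiWeight ha (fun l => σ (e l)) fun l => τ (e l)).const_mul _]
  refine Finset.sum_congr rfl fun σ _ => ?_
  rw [integral_finsetSum _ fun τ _ =>
    (integrable_prod_jacobiWeight ha (fun l => σ (e l)) fun l => τ (e l)).const_mul _]
  rw [Finset.sum_eq_single σ]
  · rw [integral_const_mul,
      integral_prod_jacobiWeight ha hp (fun l => σ (e l)) (fun l => σ (e l)), if_pos rfl]
    have : ((Equiv.Perm.sign σ : ℤ) : ℝ) * ((Equiv.Perm.sign σ : ℤ) : ℝ) = 1 := by
      norm_cast; simp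
    rw [this]; ring
  · intro τ _ hτ
    rw [integral_const_mul,
      integral_prod_jacobiWeight ha hp (fun l => σ (e l)) (fun l => τ (e l)),
      if_neg fun hst => hτ (he σ τ hst).symm, mul_zero]
  · simp

theorem jacobiNorm_two (ha : -1 < a) (hm : ∀ n, (p n).Monic) (hd : ∀ n, (p n).natDegree = n)
    (hp : ∀ i j, jacobiFunctional ha (p i * p j) = if i = j then h i else 0) (n : ℕ) :
    jacobiNorm 2 a a n = n.factorial * ∏ i : Fin n, h i := by
  have key := integral_sq_sum_perm ha hp (n := n) (m := n) id
    (fun σ τ hst => Equiv.ext fun i => congrFun hst i) (fun _ => 1)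
  simp only [one_mul, one_pow, id] at key
  simp only [jacobiNorm, jacobiJoint_two_eq_det hm hd]
  rw [key]
  have : ∀ σ : Equiv.Perm (Fin n), ∏ i, h (σ i) = ∏ i : Fin n, h i := fun σ =>
    Equiv.prod_comp σ fun i : Fin n => h i
  simp [this, Fintype.card_perm]

/-- The one-point density is the weight times the Christoffel-Darboux kernel on the diagonal. -/
theorem jacobiDensity_two (ha : -1 < a) (hm : ∀ n, (p n).Monic) (hd : ∀ n, (p n).natDegree = n)
    (hp : ∀ i j, jacobiFunctional ha (p i * p j) = if i = j then h i else 0)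
    (h0 : ∀ i, h i ≠ 0) (n : ℕ) (x : ℝ) :
    jacobiDensity 2 a a (n + 1) x = jacobiWeight a a x *
      ∑ j ∈ Finset.range (n + 1), (p j).eval x ^ 2 / h j := by
  have key := integral_sq_sum_perm ha hp (n := n) (m := n + 1) Fin.succ (fun σ τ hst => by
      have hs : ∀ i : Fin n, σ i.succ = τ i.succ := fun i => congrFun hst i
      -- permutations agreeing off one point agree there too
      have hz : σ 0 = τ 0 := by
        obtain ⟨j, hj⟩ := τ.surjective (σ 0)
        cases j using Fin.cases with
        | zero => exact hj.symm
        | succ j =>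
          rw [← hs j] at hj
          exact absurd (σ.injective hj) (Fin.succ_ne_zero j)
      exact Equiv.ext fun i => Fin.cases hz hs i) (fun σ => (p (σ 0)).eval x)
  have hint : ∫ y : Fin (n + 1 - 1) → ℝ, (∏ l, |x - y l| ^ (2 : ℝ)) *
      jacobiJoint 2 a a (n + 1 - 1) y =
      ∑ σ : Equiv.Perm (Fin (n + 1)), (p (σ 0)).eval x ^ 2 * ∏ i : Fin n, h (σ i.succ) := by
    rw [← key]
    change ∫ y : Fin n → ℝ, (∏ l, |x - y l| ^ (2 : ℝ)) * jacobiJoint 2 a a n y = _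
    simp only [prod_sq_mul_jacobiJoint_two hm hd]
  have hprod : ∀ σ : Equiv.Perm (Fin (n + 1)),
      (p (σ 0)).eval x ^ 2 * ∏ i : Fin n, h (σ i.succ) =
        (∏ i : Fin (n + 1), h i) * ((p (σ 0)).eval x ^ 2 / h (σ 0)) := by
    intro σ
    rw [← Equiv.prod_comp σ fun i : Fin (n + 1) => h i, Fin.prod_univ_succ]
    field_simp [h0 (σ 0)]
  have hsum : ∀ g : Fin (n + 1) → ℝ,
      ∑ σ : Equiv.Perm (Fin (n + 1)), g (σ 0) = n.factorial * ∑ j, g j := by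
    intro g
    rw [← Equiv.sum_comp Equiv.Perm.decomposeFin.symm, Fintype.sum_prod_type]
    simp [Fintype.card_perm, Finset.mul_sum]
  have hP : ∏ i : Fin (n + 1), h i ≠ 0 := Finset.prod_ne_zero_iff.2 fun i _ => h0 i
  have hf : (n.factorial : ℝ) ≠ 0 := by exact_mod_cast n.factorial_ne_zero
  have hn : (n : ℝ) + 1 ≠ 0 := by positivity
  rw [jacobiDensity, hint, jacobiNorm_two ha hm hd hp]
  simp only [hprod]
  rw [← Finset.mul_sum, hsum fun j => (p j).eval x ^ 2 / h j,
    ← Fin.sum_univ_eq_sum_range (fun j => (p j).eval x ^ 2 / h j), Nat.factorial_succ]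
  push_cast
  generalize ∑ j : Fin (n + 1), (p j).eval x ^ 2 / h j = S
  field_simp

end Determinantal

/-! ### The difference equation of continuous Hahn polynomials -/

theorem poch_zero (z : ℂ) : poch z 0 = 1 := by simp [poch]

theorem poch_succ (z : ℂ) (n : ℕ) : poch z (n + 1) = poch z n * (z + n) :=
  ascPochhammer_succ_eval n z

theorem poch_succ_left (z : ℂ) (n : ℕ) : poch z (n + 1) = z * poch (z + 1) n := by
  simp [poch, ascPochhammer_succ_left]

theorem poch_ne_zero {z : ℂ} {n : ℕ} (h : ∀ j < n, z + j ≠ 0) : poch z n ≠ 0 := by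
  induction n with
  | zero => simp [poch_zero]
  | succ n ih =>
    rw [poch_succ]
    exact mul_ne_zero (ih fun j hj => h j (by omega)) (h n (by omega))

theorem poch_neg_nat_eq_zero {n j : ℕ} (h : n < j) : poch (-(n : ℂ)) j = 0 := by
  induction j with
  | zero => omega
  | succ j ih =>
    rw [poch_succ]
    rcases Nat.lt_succ_iff_lt_or_eq.1 h with h | h
    · rw [ih h, zero_mul]
    · rw [h]; simp

theorem poch_two (n : ℕ) : poch 2 n = (n + 1).factorial := by
  induction n with
  | zero => simp [poch_zero]
  | succ n ih =>
    rw [poch_succ, ih, Nat.factorial_succ (n + 1)]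
    push_cast; ring

/-- Coefficient of `(-k)_j` in `₃F₂(-n, β, -k; 2, b; 1)`. -/
noncomputable def hahnCoeff (n : ℕ) (β b : ℂ) (j : ℕ) : ℂ :=
  poch (-n) j * poch β j / (poch 2 j * poch b j * j.factorial)

/-- The terminating series `₃F₂(-n, β, -k; 2, b; 1)` as a polynomial in `k`. -/
noncomputable def hahnPolynomial (n : ℕ) (β b : ℂ) : ℂ[X] :=
  ∑ j ∈ Finset.range (n + 1), C (hahnCoeff n β b j) * (ascPochhammer ℂ j).comp (-X)

theorem hahnPolynomial_eval (n : ℕ) (β b k : ℂ) :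
    (hahnPolynomial n β b).eval k =
      ∑ j ∈ Finset.range (n + 1), hahnCoeff n β b j * poch (-k) j := by
  simp [hahnPolynomial, eval_finsetSum, poch]

theorem hahnPolynomial_natDegree_le (n : ℕ) (β b : ℂ) :
    (hahnPolynomial n β b).natDegree ≤ n := by
  refine natDegree_sum_le_of_forall_le _ _ fun j hj => ?_
  refine (natDegree_C_mul_le _ _).trans ?_
  rw [natDegree_comp, natDegree_neg, natDegree_X, ascPochhammer_natDegree, mul_one]
  have := Finset.mem_range.1 hj
  omega

theorem hahnPolynomial_eval_zero (n : ℕ) (β b : ℂ) : (hahnPolynomial n β b).eval 0 = 1 := by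
  rw [hahnPolynomial_eval, Finset.sum_eq_single 0]
  · simp [hahnCoeff, poch_zero]
  · intro j _ hj
    obtain ⟨m, rfl⟩ := Nat.exists_eq_succ_of_ne_zero hj
    rw [poch_succ_left]; simp
  · simp

theorem hypergeometric32_eq_hahnPolynomial (n : ℕ) (β b k : ℂ) :
    hypergeometric32 (-(n : ℂ)) β (-k) 2 b 1 = (hahnPolynomial n β b).eval k := by
  rw [hypergeometric32, hahnPolynomial_eval, tsum_eq_sum (s := Finset.range (n + 1))]
  · refine Finset.sum_congr rfl fun j _ => ?_
    rw [hahnCoeff, one_pow]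
    field_simp
  · intro j hj
    rw [poch_neg_nat_eq_zero (by simpa using hj)]
    simp

/-- The second-order difference operator of which the continuous Hahn polynomials are the
eigenfunctions, in the variable `k`. -/
noncomputable def hahnOperator (b : ℂ) (f : ℂ → ℂ) (k : ℂ) : ℂ :=
  (k + 2) * (k + b) * (f (k + 1) - f k) + k * (k + 2 - b) * (f (k - 1) - f k)

/-- On the basis `(-k)_j` the difference operator is bidiagonal. -/
theorem hahnOperator_poch (b k : ℂ) (j : ℕ) :
    hahnOperator b (fun z => poch (-z) (j + 1)) k =
      (j + 1) * (2 * b + j) * poch (-k) (j + 1) -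
        (j + 1) * (j + 2) * (j + b) * poch (-k) j := by
  have e1 : poch (-(k + 1)) (j + 1) = -(k + 1) * poch (-k) j := by
    rw [poch_succ_left]; ring_nf
  have e2 : poch (-k) (j + 1) = poch (-k) j * (-k + j) := poch_succ _ _
  have e3 : k * poch (-(k - 1)) (j + 1) = -(poch (-k) j * (-k + j)) * (1 - k + j) := by
    rw [← e2, poch_succ_left (-k), poch_succ]
    ring_nf
  simp only [hahnOperator]
  rw [e1, e2]
  linear_combination (k + 2 - b) * e3

theorem hahnPolynomial_operator {n : ℕ} {β b : ℂ} (hβ : β = 2 * b - 1 + n)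
    (hb : ∀ j < n, b + j ≠ 0) (k : ℂ) :
    hahnOperator b (fun z => (hahnPolynomial n β b).eval z) k =
      n * β * (hahnPolynomial n β b).eval k := by
  -- the partial sums telescope
  have key : ∀ m ≤ n,
      hahnOperator b (fun z => ∑ j ∈ Finset.range (m + 1), hahnCoeff n β b j * poch (-z) j) k -
        n * β * ∑ j ∈ Finset.range (m + 1), hahnCoeff n β b j * poch (-k) j =
      hahnCoeff n β b m * (-n + m) * (β + m) * poch (-k) m := by
    intro m
    induction m with
    | zero => intro _; simp [hahnOperator, poch_zero]; ring
    | succ m ih =>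
      intro hm
      have ih := ih (by omega)
      have hc : hahnCoeff n β b (m + 1) * ((m + 1) * (m + 2) * (m + b)) =
          hahnCoeff n β b m * (-n + m) * (β + m) := by
        have h1 : poch b m ≠ 0 := poch_ne_zero fun j hj => hb j (by omega)
        have h2 : b + m ≠ 0 := hb m (by omega)
        have h3 : poch 2 m ≠ 0 := by rw [poch_two]; exact_mod_cast Nat.factorial_ne_zero _
        have h4 : (m.factorial : ℂ) ≠ 0 := by exact_mod_cast Nat.factorial_ne_zero _
        have h5 : (m : ℂ) + 1 ≠ 0 := by exact_mod_cast Nat.succ_ne_zero m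
        have h6 : (2 : ℂ) + m ≠ 0 := by
          have : ((2 + m : ℕ) : ℂ) ≠ 0 := by exact_mod_cast (by omega : 2 + m ≠ 0)
          exact_mod_cast this
        simp only [hahnCoeff, poch_succ, Nat.factorial_succ]
        push_cast
        field_simp
        ring
      have hop := hahnOperator_poch b k m
      simp only [Finset.sum_range_succ _ (m + 1)]
      simp only [hahnOperator] at hop ih ⊢
      subst hβ
      push_cast
      linear_combination ih + hahnCoeff n (2 * b - 1 + n) b (m + 1) * hop - poch (-k) m * hc
  have h := key n le_rfl
  simp only [← hahnPolynomial_eval] at h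
  rw [neg_add_cancel, mul_zero, zero_mul, zero_mul] at h
  linear_combination h

/-- A polynomial of degree at most `n` which satisfies the difference equation at
`k = 0, …, n - 1` is determined by its value at zero: the equation at `k = 0` has no term in
`k - 1`, so that it can be solved forward. -/
theorem eq_hahnPolynomial_of_operator {n : ℕ} {β b : ℂ} (hβ : β = 2 * b - 1 + n)
    (hb : ∀ j < n, b + j ≠ 0) {P : ℂ[X]} (hP : P.natDegree ≤ n)
    (hrec : ∀ k < n, hahnOperator b (fun z => P.eval z) k = n * β * P.eval (k : ℂ)) :
    P = C (P.eval 0) * hahnPolynomial n β b := by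
  set Q := C (P.eval 0) * hahnPolynomial n β b with hQ
  have hQ0 : Q.eval 0 = P.eval 0 := by simp [hQ, hahnPolynomial_eval_zero]
  have hQrec : ∀ k : ℂ, hahnOperator b (fun z => Q.eval z) k = n * β * Q.eval k := by
    intro k
    have := hahnPolynomial_operator hβ hb k
    simp only [hahnOperator, hQ, eval_mul, eval_C] at this ⊢
    linear_combination P.eval 0 * this
  have step : ∀ k : ℕ, k < n → P.eval (k : ℂ) = Q.eval (k : ℂ) →
      (k : ℂ) * (P.eval ((k : ℂ) - 1) - Q.eval ((k : ℂ) - 1)) = 0 →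
      P.eval ((k : ℂ) + 1) = Q.eval ((k : ℂ) + 1) := by
    intro k hk h0 h1
    have hp := hrec k hk
    have hq := hQrec k
    simp only [hahnOperator] at hp hq
    have n1 : (k : ℂ) + 2 ≠ 0 := by exact_mod_cast (by omega : k + 2 ≠ 0)
    have n2 : (k : ℂ) + b ≠ 0 := by rw [add_comm]; exact hb k hk
    apply mul_left_cancel₀ (mul_ne_zero n1 n2)
    linear_combination hp - hq +
      (n * β + (k + 2) * (k + b) + k * (k + 2 - b)) * h0 - (k + 2 - b) * h1
  have hall : ∀ k : ℕ, k ≤ n → P.eval (k : ℂ) = Q.eval (k : ℂ) := by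
    intro k
    induction k using Nat.twoStepInduction with
    | zero => intro _; simp [hQ0]
    | one =>
      intro h
      have := step 0 h (by simp [hQ0]) (by simp)
      simpa using this
    | more k h0 h1 =>
      intro h
      have := step (k + 1) (by omega) (h1 (by omega)) (by
        have := h0 (by omega)
        push_cast
        rw [add_sub_cancel_right, this, sub_self, mul_zero])
      have e : ((k + 1 : ℕ) : ℂ) + 1 = ((k + 2 : ℕ) : ℂ) := by push_cast; ring
      rwa [e] at this
  refine eq_of_natDegree_lt_card_of_eval_eq P Q (f := fun i : Fin (n + 1) => ((i : ℕ) : ℂ)) ?_ ?_ ?_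
  · exact fun i j h => Fin.ext (Nat.cast_injective (R := ℂ) h)
  · exact fun i => hall i (by omega)
  · rw [Fintype.card_fin]
    have : Q.natDegree ≤ n := (natDegree_C_mul_le _ _).trans (hahnPolynomial_natDegree_le _ _ _)
    omega

/-! ### Moment differences of the symmetric Jacobi ensemble -/

theorem gegenbauerWronskian_natDegree_le (a : ℝ) (n : ℕ) :
    (gegenbauerWronskian a n).natDegree ≤ 2 * n := by
  have h0 := (monicGegenbauer.monic_and_natDegree a n).2
  have h1 := (monicGegenbauer.monic_and_natDegree a (n + 1)).2
  rw [gegenbauerWronskian]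
  refine (natDegree_sub_le _ _).trans (max_le ?_ ?_)
  · refine natDegree_mul_le.trans ?_
    have := natDegree_derivative_le (monicGegenbauer a (n + 1))
    omega
  · cases n with
    | zero => simp [monicGegenbauer]
    | succ n =>
      refine natDegree_mul_le.trans ?_
      have := natDegree_derivative_le (monicGegenbauer a (n + 1))
      omega

section Jacobi

variable {a : ℝ}

open monicGegenbauer

/-- The squared norms of the monic orthogonal polynomials. -/
noncomputable def gegenbauerNormSq (ha : -1 < a) (n : ℕ) : ℝ :=
  jacobiFunctional ha (monicGegenbauer a n * monicGegenbauer a n)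

theorem gegenbauerNormSq_ne_zero (ha : -1 < a) (ha' : a ≠ -1 / 2) (n : ℕ) :
    gegenbauerNormSq ha n ≠ 0 :=
  (isPearson_jacobiFunctional ha).map_sq_ne_zero ha ha' (jacobiFunctional_one_pos ha).ne' n

/-- The diagonal Christoffel-Darboux kernel as a polynomial. -/
noncomputable def gegenbauerKernel (ha : -1 < a) (n : ℕ) : ℝ[X] :=
  C (gegenbauerNormSq ha n)⁻¹ * gegenbauerWronskian a n

theorem jacobiDensity_two_eq_kernel (ha : -1 < a) (ha' : a ≠ -1 / 2) (n : ℕ) (x : ℝ) :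
    jacobiDensity 2 a a (n + 1) x = (Set.Ioo (-1 : ℝ) 1).indicator
      (fun t => (1 - t ^ 2) ^ a * (gegenbauerKernel ha n).eval t) x := by
  rw [jacobiDensity_two (p := monicGegenbauer a) (h := gegenbauerNormSq ha) ha
    (fun n => (monic_and_natDegree a n).1) (fun n => (monic_and_natDegree a n).2) ?_
    (gegenbauerNormSq_ne_zero ha ha')]
  · have h := (isPearson_jacobiFunctional ha).christoffelDarboux ha ha'
      (jacobiFunctional_one_pos ha).ne' n x
    simp only [gegenbauerNormSq]
    rw [h, ← jacobiWeight_symm_mul, gegenbauerKernel, eval_mul, eval_C, div_eq_inv_mul]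
    rfl
  · intro i j
    split_ifs with hij
    · subst hij; rfl
    · exact (isPearson_jacobiFunctional ha).orthogonal ha ha' hij

theorem cpow_mul_jacobiDensity_two (ha : -1 < a) (ha' : a ≠ -1 / 2) (n : ℕ) (k : ℂ) {x : ℝ}
    (hx : x ∈ Set.Ioo (-1 : ℝ) 1) :
    ((|x| : ℝ) : ℂ) ^ (2 * k) * (jacobiDensity 2 a a (n + 1) x : ℂ) =
      ((|x| : ℝ) : ℂ) ^ (2 * k) *
        (((1 - x ^ 2) ^ a * (gegenbauerKernel ha n).eval x : ℝ) : ℂ) := by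
  rw [jacobiDensity_two_eq_kernel ha ha', Set.indicator_of_mem hx]

theorem intervalIntegrable_jacobiMoment (ha : -1 < a) (ha' : a ≠ -1 / 2) (n : ℕ) {k : ℂ}
    (hk : -1 / 2 < k.re) :
    IntervalIntegrable
      (fun x : ℝ => ((|x| : ℝ) : ℂ) ^ (2 * k) * (jacobiDensity 2 a a (n + 1) x : ℂ))
      volume (-1) 1 := by
  have h := abs_mellin_polynomial_integrable hk ha (gegenbauerKernel ha n)
  rw [intervalIntegrable_iff_integrableOn_Ioo_of_le (by norm_num)] at h ⊢
  exact h.congr_fun (fun x hx => (cpow_mul_jacobiDensity_two ha ha' n k hx).symm)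
    measurableSet_Ioo

/-- The moment difference as a single integral against `(1 - x²)^(a+1)`. -/
theorem jacobiMu_two (ha : -1 < a) (ha' : a ≠ -1 / 2) (n : ℕ) {k : ℂ} (hk : -1 / 2 < k.re) :
    jacobiMu 2 a (n + 1) k = -∫ x in (-1 : ℝ)..1, ((|x| : ℝ) : ℂ) ^ (2 * k) *
      (((1 - x ^ 2) ^ (a + 1) * (gegenbauerKernel ha n).eval x : ℝ) : ℂ) := by
  have hk1 : -1 / 2 < (k + 1).re := by simp; linarith
  rw [jacobiMu, jacobiMoment, jacobiMoment,
    ← intervalIntegral.integral_sub (intervalIntegrable_jacobiMoment ha ha' n hk1)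
      (intervalIntegrable_jacobiMoment ha ha' n hk), ← intervalIntegral.integral_neg]
  rw [intervalIntegral.integral_of_le (by norm_num), intervalIntegral.integral_of_le (by norm_num),
    integral_Ioc_eq_integral_Ioo, integral_Ioc_eq_integral_Ioo]
  have hae : ∀ᵐ x : ℝ ∂volume, x ≠ 0 := by
    simp [ae_iff, measure_singleton]
  refine setIntegral_congr_ae measurableSet_Ioo (hae.mono fun x hx0 hx => ?_)
  rw [cpow_mul_jacobiDensity_two ha ha' n k hx, cpow_mul_jacobiDensity_two ha ha' n (k + 1) hx]
  have hs : 0 < 1 - x ^ 2 := by nlinarith [hx.1, hx.2]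
  have hxc : ((|x| : ℝ) : ℂ) ≠ 0 := by exact_mod_cast (abs_pos.2 hx0).ne'
  have e : ((|x| : ℝ) : ℂ) ^ (2 * (k + 1)) = ((|x| : ℝ) : ℂ) ^ (2 * k) * (x : ℂ) ^ 2 := by
    rw [mul_add, mul_one, Complex.cpow_add _ _ hxc, Complex.cpow_ofNat]
    congr 1
    rw [← Complex.ofReal_pow, sq_abs, Complex.ofReal_pow]
  rw [e, Real.rpow_add_one hs.ne']
  push_cast
  ring

theorem integral_nat_eq_wronskianMoment (ha : -1 < a) (n k : ℕ) :
    ∫ x in (-1 : ℝ)..1, ((|x| : ℝ) : ℂ) ^ (2 * (k : ℂ)) *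
      (((1 - x ^ 2) ^ (a + 1) * (gegenbauerKernel ha n).eval x : ℝ) : ℂ) =
    ((wronskianMoment a n (jacobiFunctional ha) k / gegenbauerNormSq ha n : ℝ) : ℂ) := by
  have h : wronskianMoment a n (jacobiFunctional ha) k / gegenbauerNormSq ha n =
      ∫ x in (-1 : ℝ)..1, x ^ (2 * k) *
        ((1 - x ^ 2) ^ (a + 1) * (gegenbauerKernel ha n).eval x) := by
    rw [wronskianMoment, jacobiFunctional_apply, integral_jacobiWeight_mul, div_eq_inv_mul,
      ← intervalIntegral.integral_const_mul]
    rw [intervalIntegral.integral_of_le (by norm_num),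
      intervalIntegral.integral_of_le (by norm_num),
      integral_Ioc_eq_integral_Ioo, integral_Ioc_eq_integral_Ioo]
    refine setIntegral_congr_fun measurableSet_Ioo fun x hx => ?_
    have hs : 0 < 1 - x ^ 2 := by nlinarith [hx.1, hx.2]
    simp only [gegenbauerKernel, eval_mul, eval_pow, eval_X, eval_sub, eval_one, eval_C]
    rw [Real.rpow_add_one hs.ne']
    ring
  rw [h, ← intervalIntegral.integral_ofReal]
  congr 1
  ext x
  have e : ((|x| : ℝ) : ℂ) ^ (2 * (k : ℂ)) = (x : ℂ) ^ (2 * k) := by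
    have : (2 * (k : ℂ)) = ((2 * k : ℕ) : ℂ) := by push_cast; ring
    rw [this, Complex.cpow_natCast, pow_mul, pow_mul, ← Complex.ofReal_pow, sq_abs,
      Complex.ofReal_pow]
  rw [e]
  push_cast
  ring

/-- The lower Pochhammer symbol of the terminating series has no zero factor before the series
stops; for `n ≥ 1` the excluded value `a = -1/2` is the only one in `a > -1` where it would. -/
theorem three_half_sub_add_ne_zero (ha : -1 < a) (ha' : a ≠ -1 / 2) (n : ℕ) :
    ∀ j < n, (3 / 2 - (a + (n + 1)) : ℂ) + j ≠ 0 := by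
  intro j hj hz
  have hz' : (3 / 2 - (a + ((n : ℝ) + 1)) + j : ℝ) = 0 := by
    have : ((3 / 2 - (a + ((n : ℝ) + 1)) + j : ℝ) : ℂ) = 0 := by
      rw [← hz]; push_cast; ring
    exact_mod_cast this
  rcases Nat.lt_or_ge (j + 1) n with h | h
  · have : (j : ℝ) + 2 ≤ n := by exact_mod_cast h
    linarith
  · have : (n : ℝ) = j + 1 := by exact_mod_cast (by omega : n = j + 1)
    apply ha'
    linarith

/-- The rescaled moment difference is its value at zero times a terminating `₃F₂`. -/
theorem gamma_mul_jacobiMu_two (ha : -1 < a) (ha' : a ≠ -1 / 2) (n : ℕ) {k : ℂ}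
    (hk : -1 / 2 < k.re) :
    Complex.Gamma (k + n + a + 5 / 2) / Complex.Gamma (k + 1 / 2) * jacobiMu 2 a (n + 1) k =
      jacobiMuTildeZero a (n + 1) *
        (hahnPolynomial n (-n - 2 * a) (3 / 2 - (a + (n + 1)))).eval k := by
  set b : ℂ := 3 / 2 - (a + (n + 1)) with hbdef
  obtain ⟨P, hP, hPk⟩ := exists_polynomial_abs_mellin (b := a + 1) (by linarith) n
    (gegenbauerKernel ha n) ((natDegree_C_mul_le _ _).trans (gegenbauerWronskian_natDegree_le a n))
  set h := gegenbauerNormSq ha n with hh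
  have h0 : (h : ℂ) ≠ 0 := by exact_mod_cast gegenbauerNormSq_ne_zero ha ha' n
  have hb : ∀ j < n, b + j ≠ 0 := three_half_sub_add_ne_zero ha ha' n
  set G : ℂ → ℂ := fun z => Complex.Gamma (z + n + a + 5 / 2) / Complex.Gamma (z + 1 / 2) with hG
  have hGP : ∀ k : ℂ, Complex.Gamma (k + n + ((a + 1 : ℝ) : ℂ) + 3 / 2) /
      Complex.Gamma (k + 1 / 2) = G k := by
    intro k; simp only [hG]; congr 2; push_cast; ring
  simp only [hGP] at hPk
  have hnn : (0 : ℝ) ≤ n := Nat.cast_nonneg n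
  have hGrec : ∀ j : ℕ, ((j : ℂ) + 1 / 2) * G (j + 1) = (j + n + a + 5 / 2) * G j := by
    intro j
    have hj : (0 : ℝ) ≤ j := Nat.cast_nonneg j
    have r1 : 0 < ((j : ℂ) + 1 / 2).re := by simp; linarith
    have r2 : 0 < ((j : ℂ) + n + a + 5 / 2).re := by simp; linarith
    have z1 : (j : ℂ) + 1 / 2 ≠ 0 := fun h => by rw [h] at r1; simp at r1
    have z2 : (j : ℂ) + n + a + 5 / 2 ≠ 0 := fun h => by rw [h] at r2; simp at r2
    have g1 := Complex.Gamma_add_one _ z1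
    have g2 := Complex.Gamma_add_one _ z2
    have e1 : (j : ℂ) + 1 + 1 / 2 = j + 1 / 2 + 1 := by ring
    have e2 : (j : ℂ) + 1 + n + a + 5 / 2 = j + n + a + 5 / 2 + 1 := by ring
    have n1 := Complex.Gamma_ne_zero_of_re_pos r1
    simp only [hG]
    rw [e1, e2, g1, g2]
    generalize Complex.Gamma ((j : ℂ) + 1 / 2) = y at *
    rw [← mul_div_assoc, mul_div_mul_left _ _ z1, mul_div_assoc]
  have hPnat : ∀ j : ℕ, P.eval (j : ℂ) =
      G j * (wronskianMoment a n (jacobiFunctional ha) j / h : ℂ) := by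
    intro j
    have hj : (0 : ℝ) ≤ j := Nat.cast_nonneg j
    rw [← hPk j (by simp; linarith), integral_nat_eq_wronskianMoment ha]
    push_cast; rfl
  have hrec : ∀ j < n, hahnOperator b (fun z => P.eval z) (j : ℂ) =
      n * (-n - 2 * a) * P.eval (j : ℂ) := by
    intro j _
    have R := (isPearson_jacobiFunctional ha).wronskianMoment_recurrence ha ha' n j
    have R' := congrArg (fun x : ℝ => (x : ℂ)) R
    push_cast at R'
    have g := hGrec j
    have hj : (0 : ℝ) ≤ j := Nat.cast_nonneg j
    have z1 : (j : ℂ) + 1 / 2 ≠ 0 := by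
      intro h
      have := congrArg Complex.re h
      simp at this; linarith
    have p1 := hPnat (j + 1)
    have p0 := hPnat j
    push_cast at p1
    simp only [hahnOperator]
    rw [p1, p0]
    apply mul_left_cancel₀ z1
    cases j with
    | zero =>
      simp only [Nat.cast_zero, zero_mul, zero_add, zero_sub, Nat.zero_sub] at *
      rw [hbdef]
      linear_combination (G 0 / h) * R' + 2 * (3 / 2 - (a + (n + 1))) *
        (wronskianMoment a n (jacobiFunctional ha) 1 / h) * g
    | succ j =>
      have g' := hGrec j
      have p2 := hPnat j
      rw [Nat.add_sub_cancel] at R'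
      push_cast at R' g ⊢
      rw [add_sub_cancel_right, p2, hbdef]
      linear_combination (G (j + 1) / h) * R' +
        (j + 1 + 2) * (j + 1 + (3 / 2 - (a + (n + 1)))) *
          (wronskianMoment a n (jacobiFunctional ha) (j + 1 + 1) / h) * g -
        (j + 1) * (j + 1 + 1 / 2) * (wronskianMoment a n (jacobiFunctional ha) j / h) * g'
  have hfin := eq_hahnPolynomial_of_operator (b := b) (β := -n - 2 * a)
    (by rw [hbdef]; ring) hb hP hrec
  have hP0 : -P.eval 0 = jacobiMuTildeZero a (n + 1) := by
    have h1 := hPnat 0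
    rw [(isPearson_jacobiFunctional ha).wronskianMoment_zero ha ha' n] at h1
    have hD : (2 * n + 2 * a + 3 : ℂ) * (2 * n + 2 * a + 1) ≠ 0 := by
      have h1 := two_mul_add_one_ne_zero ha ha' n
      have h2 : 2 * (n : ℝ) + 2 * a + 3 ≠ 0 := by linarith
      exact_mod_cast mul_ne_zero h2 h1
    have hcoeff : (gegenbauerCoeff a (n + 1) : ℂ) =
        (n + 1) * (n + 1 + 2 * a) / ((2 * n + 2 * a + 3) * (2 * n + 2 * a + 1)) := by
      rw [eq_div_iff hD, mul_comm]
      exact_mod_cast coeff_succ_mul ha ha' n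
    have hden : (1 - 4 * ((a : ℂ) + (n + 1)) ^ 2) =
        -((2 * n + 2 * a + 3) * (2 * n + 2 * a + 1)) := by ring
    have eG : G 0 = Complex.Gamma ((n + 1 : ℂ) + a + 3 / 2) / Complex.Gamma (1 / 2) := by
      simp only [hG]; congr 2 <;> ring
    have hnorm : (jacobiFunctional ha (monicGegenbauer a n * monicGegenbauer a n) : ℂ) = h := rfl
    push_cast at h1
    rw [hnorm, hcoeff, eG] at h1
    rw [jacobiMuTildeZero, h1]
    push_cast
    rw [hden, div_neg, mul_neg, ← mul_assoc (2 * ((a : ℂ) + (n + 1))), mul_div_cancel_right₀ _ h0]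
    ring
  rw [jacobiMu_two ha ha' n hk, ← hP0]
  have := hPk k hk
  rw [hfin, eval_mul, eval_C] at this
  linear_combination -this

end Jacobi

theorem mainTheorem5 (N : ℕ) (hN : 1 ≤ N) (a : ℝ) (ha : -1 < a) (ha' : a ≠ -1 / 2)
    (k : ℂ) (hk : -1 / 2 < k.re) :
    -- the moments entering the definition of the moment difference are well defined
    IntervalIntegrable
      (fun x : ℝ => ((|x| : ℝ) : ℂ) ^ (2 * k) * (jacobiDensity 2 a a N x : ℂ))
      MeasureTheory.volume (-1) 1 ∧
    IntervalIntegrable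
      (fun x : ℝ => ((|x| : ℝ) : ℂ) ^ (2 * (k + 1)) * (jacobiDensity 2 a a N x : ℂ))
      MeasureTheory.volume (-1) 1 ∧
    -- the value at zero
    jacobiMuTilde 2 a N 0 = jacobiMuTildeZero a N ∧
    -- the rescaled moment difference as a continuous Hahn polynomial
    jacobiMuTilde 2 a N k =
      jacobiMuTildeZero a N * Complex.I ^ (1 - (N : ℤ)) /
          (N * poch (3 / 2 - (a + N)) (N - 1)) *
        continuousHahnConj (N - 1) (Complex.I * (k + 1)) 1 (1 / 2 - (a + N)) ∧
    -- the moment difference itself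
    jacobiMu 2 a N k =
      jacobiMuTildeZero a N * Complex.I ^ (1 - (N : ℤ)) * Complex.Gamma (k + 1 / 2) /
          (N * Complex.Gamma (k + N + a + 3 / 2) * poch (3 / 2 - (a + N)) (N - 1)) *
        continuousHahnConj (N - 1) (Complex.I * (k + 1)) 1 (1 / 2 - (a + N)) := by
  obtain ⟨n, rfl⟩ := Nat.exists_eq_succ_of_ne_zero (by omega : N ≠ 0)
  set b : ℂ := 3 / 2 - (a + (n + 1)) with hbdef
  have hb : ∀ j < n, b + j ≠ 0 := three_half_sub_add_ne_zero ha ha' n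
  have hT : ∀ z : ℂ, jacobiMuTilde 2 a (n + 1) z =
      Complex.Gamma (z + n + a + 5 / 2) / Complex.Gamma (z + 1 / 2) * jacobiMu 2 a (n + 1) z := by
    intro z
    rw [jacobiMuTilde]
    congr 3
    push_cast
    ring
  have hH : continuousHahnConj n (Complex.I * (k + 1)) 1 (1 / 2 - (a + (n + 1))) =
      Complex.I ^ n * ((n + 1) * poch b n) * (hahnPolynomial n (-n - 2 * a) b).eval k := by
    have e1 : (1 : ℂ) + starRingEnd ℂ 1 = 2 := by rw [map_one]; norm_num
    have ec : starRingEnd ℂ (1 / 2 - (a + (n + 1))) = 1 / 2 - (a + (n + 1)) := by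
      simp only [map_sub, map_div₀, map_one, map_add, Complex.conj_ofReal, map_natCast, map_ofNat]
    have e2 : (1 : ℂ) + (1 / 2 - (a + (n + 1))) = b := by rw [hbdef]; ring
    have e3 : (n : ℂ) + 1 + (1 / 2 - (a + (n + 1))) + 1 + (1 / 2 - (a + (n + 1))) - 1 =
        -n - 2 * a := by ring
    have e4 : (1 : ℂ) + Complex.I * (Complex.I * (k + 1)) = -k := by
      rw [← mul_assoc, Complex.I_mul_I]; ring
    rw [continuousHahnConj, continuousHahn, e1, ec, e2, map_one, e3, e4,
      hypergeometric32_eq_hahnPolynomial, poch_two, Nat.factorial_succ]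
    have : (n.factorial : ℂ) ≠ 0 := by exact_mod_cast n.factorial_ne_zero
    push_cast
    field_simp
  have hI : Complex.I ^ (1 - ((n + 1 : ℕ) : ℤ)) * Complex.I ^ n = 1 := by
    have : (1 - ((n + 1 : ℕ) : ℤ)) = -(n : ℤ) := by push_cast; ring
    rw [this, zpow_neg, zpow_natCast]
    exact inv_mul_cancel₀ (pow_ne_zero _ Complex.I_ne_zero)
  have hp : poch b n ≠ 0 := poch_ne_zero hb
  have hN0 : (n : ℂ) + 1 ≠ 0 := by exact_mod_cast n.succ_ne_zero
  have hk1 : -1 / 2 < (k + 1).re := by simp; linarith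
  have main := gamma_mul_jacobiMu_two ha ha' n hk
  rw [← hbdef] at main
  have hnn : (0 : ℝ) ≤ n := Nat.cast_nonneg n
  have g1 : Complex.Gamma (k + 1 / 2) ≠ 0 :=
    Complex.Gamma_ne_zero_of_re_pos (by simp; linarith)
  have g2 : Complex.Gamma (k + n + a + 5 / 2) ≠ 0 :=
    Complex.Gamma_ne_zero_of_re_pos (by simp; linarith)
  have eb : (3 / 2 - ((a : ℂ) + ((n + 1 : ℕ) : ℂ))) = b := by rw [hbdef]; push_cast; ring
  have eb' : (1 / 2 - ((a : ℂ) + ((n + 1 : ℕ) : ℂ))) = 1 / 2 - (a + (n + 1)) := by push_cast; ring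
  refine ⟨intervalIntegrable_jacobiMoment ha ha' n hk, intervalIntegrable_jacobiMoment ha ha' n hk1,
    ?_, ?_, ?_⟩
  · rw [hT, gamma_mul_jacobiMu_two ha ha' n (by norm_num), hahnPolynomial_eval_zero, mul_one]
  · rw [hT, main, Nat.succ_eq_add_one, Nat.add_sub_cancel, eb, eb', hH]
    push_cast at hI ⊢
    field_simp
    linear_combination (-jacobiMuTildeZero a (n + 1) *
      (hahnPolynomial n (-n - 2 * a) b).eval k) * hI
  · rw [Nat.succ_eq_add_one, Nat.add_sub_cancel, eb, eb', hH]
    have eG : k + ((n + 1 : ℕ) : ℂ) + a + 3 / 2 = k + n + a + 5 / 2 := by push_cast; ring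
    rw [eG]
    generalize Complex.Gamma (k + n + a + 5 / 2) = y₂ at *
    generalize Complex.Gamma (k + 1 / 2) = y₁ at *
    push_cast at hI ⊢
    rw [div_mul_eq_mul_div, div_eq_iff g1] at main
    apply mul_left_cancel₀ g2
    rw [main]
    field_simp
    linear_combination (-jacobiMuTildeZero a (n + 1) *
      (hahnPolynomial n (-n - 2 * a) b).eval k) * hI
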